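/- A finite group $G$ is said to be of \emph{central type} if there is a 2-cocycle $f\in Z^2(G,\mathbb{C}^*)$ (trivial action) such that the twisted group algebra $\mathbb{C}^fG$ is simple; here $\mathbb{C}^fG$ is the complex algebra with basis $\{u_g\}_{g\in G}$ and multiplication $u_xu_y=f(x,y)u_{xy}$. Write $[x,y]=xyx^{-1}y^{-1}$ and $C_n$ for the cyclic group of order $n$, and put $$G_{(\mathrm{ix})}=\langle a,b,c \mid a^4=b^2=c^2=1,\ [a,b]=[b,c]=1,\ [a,c]=a^2\rangle,$$ $$G_{(\mathrm{x})}=\langle a,b,c \mid a^4=b^2=c^2=1,\ [a,b]=[b,c]=1,\ [a,c]=b\rangle.$$ Then, up to isomorphism, the groups of central type of order $16$ are exactly the four groups $C_4\times C_4$, $C_2^4$, $G_{(\mathrm{ix})}$ and $G_{(\mathrm{x})}$: a group $G$ has order $16$ and is of central type if and only if it is isomorphic to one of them. Moreover $G_{(\mathrm{ix})}$ and $G_{(\mathrm{x})}$ are nonabelian, and no two of the four groups are isomorphic. -/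

import Mathlib

universe u

/-- A 2-cocycle `f ∈ Z²(G, ℂˣ)` of a group `G`, acting trivially on `ℂˣ`. -/
@[ext] structure TwoCocycle (G : Type u) [Group G] where
  toFun : G → G → ℂˣ
  cocycle : ∀ x y z : G, toFun x y * toFun (x * y) z = toFun y z * toFun x (y * z)

/-- The twisted group algebra `ℂ^f G`: the complex vector space with basis `(u_g)_{g ∈ G}` and the
multiplication determined by `u_x * u_y = f(x, y) u_{xy}`. -/
def TwistedGroupAlgebra {G : Type u} [Group G] (_f : TwoCocycle G) : Type u := G →₀ ℂ

namespace TwistedGroupAlgebra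

variable {G : Type u} [Group G] (f : TwoCocycle G)

noncomputable instance : AddCommGroup (TwistedGroupAlgebra f) :=
  inferInstanceAs (AddCommGroup (G →₀ ℂ))

noncomputable instance : Module ℂ (TwistedGroupAlgebra f) :=
  inferInstanceAs (Module ℂ (G →₀ ℂ))

/-- The basis `(u_g)_{g ∈ G}` of the twisted group algebra. -/
noncomputable def basis : Module.Basis G ℂ (TwistedGroupAlgebra f) :=
  Module.Basis.ofRepr (LinearEquiv.refl ℂ (G →₀ ℂ))

/-- The basis element `u_g`. -/
noncomputable def u (g : G) : TwistedGroupAlgebra f := basis f g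

/-- The multiplication, as the bilinear map with `(u_x, u_y) ↦ f(x, y) u_{xy}`. -/
noncomputable def mulMap :
    TwistedGroupAlgebra f →ₗ[ℂ] TwistedGroupAlgebra f →ₗ[ℂ] TwistedGroupAlgebra f :=
  (basis f).constr ℂ fun x => (basis f).constr ℂ fun y => (f.toFun x y : ℂ) • u f (x * y)

theorem mulMap_u (x y : G) : mulMap f (u f x) (u f y) = (f.toFun x y : ℂ) • u f (x * y) := by
  simp only [mulMap]
  rw [u, Module.Basis.constr_basis, u, Module.Basis.constr_basis]

theorem toFun_one_left (x : G) : f.toFun 1 x = f.toFun 1 1 := by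
  have h := f.cocycle 1 1 x
  simp only [one_mul] at h
  exact (mul_right_cancel h).symm

theorem toFun_one_right (x : G) : f.toFun x 1 = f.toFun 1 1 := by
  have h := f.cocycle x 1 1
  simp only [mul_one] at h
  exact mul_right_cancel h

theorem mulMap_assoc (a b c : TwistedGroupAlgebra f) :
    mulMap f (mulMap f a b) c = mulMap f a (mulMap f b c) := by
  have h₁ (x y : G) : mulMap f (mulMap f (u f x) (u f y)) =
      mulMap f (u f x) ∘ₗ mulMap f (u f y) := by
    refine (basis f).ext fun z => ?_
    change mulMap f (mulMap f (u f x) (u f y)) (u f z) =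
      mulMap f (u f x) (mulMap f (u f y) (u f z))
    rw [mulMap_u, mulMap_u, map_smul, map_smul, LinearMap.smul_apply, mulMap_u, mulMap_u,
      smul_smul, smul_smul, mul_assoc]
    congr 1
    exact_mod_cast f.cocycle x y z
  have h₂ (x : G) : (mulMap f).flip c ∘ₗ mulMap f (u f x) =
      mulMap f (u f x) ∘ₗ (mulMap f).flip c :=
    (basis f).ext fun y => DFunLike.congr_fun (h₁ x y) c
  have h₃ : (mulMap f).flip c ∘ₗ (mulMap f).flip b = (mulMap f).flip (mulMap f b c) :=
    (basis f).ext fun x => DFunLike.congr_fun (h₂ x) b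
  exact DFunLike.congr_fun h₃ a

noncomputable instance : Mul (TwistedGroupAlgebra f) := ⟨fun a b => mulMap f a b⟩

/-- The unit element is `f(1, 1)⁻¹ u_1` (and so `u_1` when `f` is normalised). -/
noncomputable instance : One (TwistedGroupAlgebra f) :=
  ⟨((f.toFun 1 1)⁻¹ : ℂˣ).val • u f 1⟩

theorem mulMap_one_left (a : TwistedGroupAlgebra f) : mulMap f 1 a = a := by
  have key : mulMap f 1 = LinearMap.id := by
    refine (basis f).ext fun x => ?_
    change mulMap f (((f.toFun 1 1)⁻¹ : ℂˣ).val • u f 1) (u f x) = u f x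
    rw [map_smul, LinearMap.smul_apply, mulMap_u, toFun_one_left f x, smul_smul, one_mul,
      Units.inv_mul, one_smul]
  exact DFunLike.congr_fun key a

theorem mulMap_one_right (a : TwistedGroupAlgebra f) : mulMap f a 1 = a := by
  have key : (mulMap f).flip 1 = LinearMap.id := by
    refine (basis f).ext fun x => ?_
    change mulMap f (u f x) (((f.toFun 1 1)⁻¹ : ℂˣ).val • u f 1) = u f x
    rw [map_smul, mulMap_u, toFun_one_right f x, smul_smul, mul_one,
      Units.inv_mul, one_smul]
  exact DFunLike.congr_fun key a

noncomputable instance : Ring (TwistedGroupAlgebra f) :=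
  { (inferInstance : AddCommGroup (TwistedGroupAlgebra f)),
    (inferInstance : Mul (TwistedGroupAlgebra f)),
    (inferInstance : One (TwistedGroupAlgebra f)) with
    left_distrib := fun a b c => (mulMap f a).map_add b c
    right_distrib := fun a b c => LinearMap.map_add₂ (mulMap f) a b c
    zero_mul := fun a => LinearMap.map_zero₂ (mulMap f) a
    mul_zero := fun a => (mulMap f a).map_zero
    mul_assoc := mulMap_assoc f
    one_mul := mulMap_one_left f
    mul_one := mulMap_one_right f }

noncomputable instance : Algebra ℂ (TwistedGroupAlgebra f) :=
  Algebra.ofModule (fun r a b => LinearMap.map_smul₂ (mulMap f) r a b)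
    (fun r a b => (mulMap f a).map_smul r b)

theorem u_mul_u (x y : G) : u f x * u f y = (f.toFun x y : ℂ) • u f (x * y) :=
  mulMap_u f x y

end TwistedGroupAlgebra

/-- A finite group `G` is of central type if some complex twisted group algebra `ℂ^f G` with
`f ∈ Z²(G, ℂˣ)` is simple. -/
def IsCentralType (G : Type u) [Group G] : Prop :=
  Finite G ∧ ∃ f : TwoCocycle G, IsSimpleRing (TwistedGroupAlgebra f)

/-- The cyclic group of order `n` (for `n ≥ 1`), written multiplicatively. -/
abbrev Cyc (n : ℕ) : Type := Multiplicative (ZMod n)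

/-- The defining relators of `⟨a, b, c ∣ a⁴ = b² = c² = 1, [a,b] = [b,c] = 1, [a,c] = a²⟩`;
the bracket is `[x,y] = x y x⁻¹ y⁻¹`. -/
def relsIX : Set (FreeGroup (Fin 3)) :=
  let a := FreeGroup.of 0
  let b := FreeGroup.of 1
  let c := FreeGroup.of 2
  {a ^ 4, b ^ 2, c ^ 2, a * b * a⁻¹ * b⁻¹, b * c * b⁻¹ * c⁻¹, a * c * a⁻¹ * c⁻¹ * (a ^ 2)⁻¹}

/-- The group `⟨a, b, c ∣ a⁴ = b² = c² = 1, [a,b] = [b,c] = 1, [a,c] = a²⟩`. -/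
abbrev GroupIX : Type := PresentedGroup relsIX

/-- The defining relators of `⟨a, b, c ∣ a⁴ = b² = c² = 1, [a,b] = [b,c] = 1, [a,c] = b⟩`;
the bracket is `[x,y] = x y x⁻¹ y⁻¹`. -/
def relsX : Set (FreeGroup (Fin 3)) :=
  let a := FreeGroup.of 0
  let b := FreeGroup.of 1
  let c := FreeGroup.of 2
  {a ^ 4, b ^ 2, c ^ 2, a * b * a⁻¹ * b⁻¹, b * c * b⁻¹ * c⁻¹, a * c * a⁻¹ * c⁻¹ * b⁻¹}

/-- The group `⟨a, b, c ∣ a⁴ = b² = c² = 1, [a,b] = [b,c] = 1, [a,c] = b⟩`. -/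
abbrev GroupX : Type := PresentedGroup relsX

/-! Write `β(x, y) = f(x, y) / f(y, x)` for commuting `x, y`. Averaging over conjugation by the
`u_h` shows that `ℂ^f G` is simple exactly when every `g ≠ 1` has some `k` in its centraliser with
`β(g, k) ≠ 1` (`isCentralType_iff`). This turns the problem into group theory, because `β` is the
commutator in the central extension of `G` by `ℂˣ` formed by the multiples of the `u_g`. Hence it is
multiplicative in each argument on centralisers and invariant under conjugation.

Each of the four groups carries an explicit cocycle with values in the fourth roots of unity,
checked on models by triples for the two nonabelian ones.

Conversely, let `G` have order 16 with `β` nondegenerate. If `G` is abelian, a value of `β` of order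
`m` gives `m²` distinct elements `a^i b^j`, so `m ≤ 4`. An element of order 4 then forces `C₄ × C₄`,
and otherwise `G` is elementary abelian.

If `G` is not abelian, take a central involution `z` and let `N` be the kernel of `β(z, ·)`. It has
index 2, and it is abelian (`commute_of_mem_ker_centralPairing`). Inside `N` the annihilator of a
non-isotropic `x` is only `{1, z, x, xz}`, so `N` is generated by `z` and any pair `x, y` with `β(x,
y) ≠ 1`. An element `g` outside `N` acts on `N` either trivially modulo `z` or by exchanging such a
pair `x, y`. Replacing `g` by `xg` where necessary makes `β` trivial between `g` and a suitable
element of `N`. The few remaining values of `g²` and `x²` each produce generators satisfying one of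
the two presentations. -/

namespace TwistedGroupAlgebra

variable {G : Type u} [Group G] (f : TwoCocycle G)

/-! ### Units, coordinates and conjugation in the twisted group algebra; the simplicity criterion.
-/

theorem one_def : (1 : TwistedGroupAlgebra f) = ((f.toFun 1 1)⁻¹ : ℂˣ).val • u f 1 := rfl

theorem u_mul_u_inv (g : G) :
    u f g * (((f.toFun g g⁻¹)⁻¹ * (f.toFun 1 1)⁻¹ : ℂˣ).val • u f g⁻¹) = 1 := by
  rw [mul_smul_comm, u_mul_u, smul_smul, mul_inv_cancel, one_def, mul_comm (_)⁻¹, Units.val_mul,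
    mul_assoc, Units.inv_mul, mul_one]

theorem u_inv_mul_u (g : G) :
    (((f.toFun g⁻¹ g)⁻¹ * (f.toFun 1 1)⁻¹ : ℂˣ).val • u f g⁻¹) * u f g = 1 := by
  rw [smul_mul_assoc, u_mul_u, smul_smul, inv_mul_cancel, one_def, mul_comm (_)⁻¹, Units.val_mul,
    mul_assoc, Units.inv_mul, mul_one]

theorem isUnit_u (g : G) : IsUnit (u f g) :=
  isUnit_iff_exists_and_exists.2 ⟨⟨_, u_mul_u_inv f g⟩, ⟨_, u_inv_mul_u f g⟩⟩

/-- The basis element `u_g`, as a unit. -/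
noncomputable def uUnit (g : G) : (TwistedGroupAlgebra f)ˣ := (isUnit_u f g).unit

@[simp] theorem val_uUnit (g : G) : (uUnit f g : TwistedGroupAlgebra f) = u f g := rfl

/-- The nonzero scalars, as units of the twisted group algebra. -/
noncomputable def scalar : ℂˣ →* (TwistedGroupAlgebra f)ˣ :=
  Units.map (algebraMap ℂ (TwistedGroupAlgebra f)).toMonoidHom

theorem val_scalar (c : ℂˣ) :
    (scalar f c : TwistedGroupAlgebra f) = algebraMap ℂ (TwistedGroupAlgebra f) c := rfl

theorem scalar_comm (c : ℂˣ) (a : (TwistedGroupAlgebra f)ˣ) : scalar f c * a = a * scalar f c :=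
  Units.ext (Algebra.commutes _ _)

theorem uUnit_mul (x y : G) : uUnit f x * uUnit f y = scalar f (f.toFun x y) * uUnit f (x * y) := by
  ext
  simp only [Units.val_mul, val_uUnit, val_scalar, ← Algebra.smul_def]
  exact u_mul_u f x y

instance : Nontrivial (TwistedGroupAlgebra f) := inferInstanceAs (Nontrivial (G →₀ ℂ))

theorem scalar_injective : Function.Injective (scalar f) :=
  Units.map_injective (algebraMap ℂ (TwistedGroupAlgebra f)).injective

theorem repr_u (g x : G) [Decidable (g = x)] :
    (basis f).repr (u f g) x = if g = x then 1 else 0 := by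
  rw [u, Module.Basis.repr_self, Finsupp.single_apply]

theorem repr_u_mul (g x : G) (a : TwistedGroupAlgebra f) :
    (basis f).repr (u f g * a) (g * x) = f.toFun g x * (basis f).repr a x := by
  classical
  have h : Finsupp.lapply (g * x) ∘ₗ (basis f).repr.toLinearMap ∘ₗ LinearMap.mulLeft ℂ (u f g) =
      (f.toFun g x : ℂ) • (Finsupp.lapply x ∘ₗ (basis f).repr.toLinearMap) := by
    refine (basis f).ext fun y => ?_
    change (basis f).repr (u f g * u f y) (g * x) = f.toFun g x * (basis f).repr (u f y) x
    rw [u_mul_u, map_smul, Finsupp.smul_apply, repr_u, repr_u, smul_eq_mul]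
    by_cases hy : y = x
    · simp [hy]
    · simp [hy]
  exact DFunLike.congr_fun h a

theorem repr_mul_u (g x : G) (a : TwistedGroupAlgebra f) :
    (basis f).repr (a * u f g) (x * g) = f.toFun x g * (basis f).repr a x := by
  classical
  have h : Finsupp.lapply (x * g) ∘ₗ (basis f).repr.toLinearMap ∘ₗ LinearMap.mulRight ℂ (u f g) =
      (f.toFun x g : ℂ) • (Finsupp.lapply x ∘ₗ (basis f).repr.toLinearMap) := by
    refine (basis f).ext fun y => ?_
    change (basis f).repr (u f y * u f g) (x * g) = f.toFun x g * (basis f).repr (u f y) x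
    rw [u_mul_u, map_smul, Finsupp.smul_apply, repr_u, repr_u, smul_eq_mul]
    by_cases hy : y = x
    · simp [hy]
    · simp [hy]
  exact DFunLike.congr_fun h a

/-- Conjugation by `u_h`. -/
noncomputable def conj (h : G) (a : TwistedGroupAlgebra f) : TwistedGroupAlgebra f :=
  u f h * a * ((uUnit f h)⁻¹ : (TwistedGroupAlgebra f)ˣ)

theorem conj_mul_u (h : G) (a : TwistedGroupAlgebra f) : conj f h a * u f h = u f h * a := by
  rw [conj, ← val_uUnit, Units.inv_mul_cancel_right]

/-- Both sides are the coefficient at `hx` of `u_h a = (u_h a u_h⁻¹) u_h`. The factor on the left is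
kept so that nothing is divided and no normalisation of `f` is needed. -/
theorem repr_conj_mul (h x : G) (a : TwistedGroupAlgebra f) :
    f.toFun (h * x * h⁻¹) h * (basis f).repr (conj f h a) (h * x * h⁻¹) =
      f.toFun h x * (basis f).repr a x := by
  rw [← repr_mul_u, conj_mul_u, inv_mul_cancel_right, repr_u_mul]

theorem conj_mul (k h : G) (a : TwistedGroupAlgebra f) :
    conj f (k * h) a = conj f k (conj f h a) := by
  refine (isUnit_u f (k * h)).mul_right_cancel ?_
  rw [conj_mul_u]
  have e : u f k * u f h * a = conj f k (conj f h a) * (u f k * u f h) := by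
    rw [← mul_assoc, conj_mul_u, mul_assoc _ _ (u f h), conj_mul_u, mul_assoc]
  rw [u_mul_u, smul_mul_assoc, mul_smul_comm] at e
  exact (IsUnit.smul_left_cancel (f.toFun k h).isUnit).1 e

theorem conj_sum (h : G) {ι : Type*} (s : Finset ι) (a : ι → TwistedGroupAlgebra f) :
    conj f h (∑ i ∈ s, a i) = ∑ i ∈ s, conj f h (a i) := by
  simp only [conj, Finset.mul_sum, Finset.sum_mul]

theorem repr_conj_one (h : G) (a : TwistedGroupAlgebra f) :
    (basis f).repr (conj f h a) 1 = (basis f).repr a 1 := by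
  have e := repr_conj_mul f h 1 a
  rw [mul_one, mul_inv_cancel, toFun_one_left, toFun_one_right f h] at e
  exact mul_left_cancel₀ (f.toFun 1 1).ne_zero e

/-- The sum of all conjugates of an element under the basis. -/
noncomputable def conjSum [Fintype G] (a : TwistedGroupAlgebra f) : TwistedGroupAlgebra f :=
  ∑ h : G, conj f h a

theorem conj_conjSum [Fintype G] (k : G) (a : TwistedGroupAlgebra f) :
    conj f k (conjSum f a) = conjSum f a := by
  rw [conjSum, conj_sum]
  simp only [← conj_mul]
  exact Fintype.sum_equiv (Equiv.mulLeft k) _ _ fun _ => rfl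

theorem u_mul_conjSum [Fintype G] (k : G) (a : TwistedGroupAlgebra f) :
    u f k * conjSum f a = conjSum f a * u f k := by
  rw [← conj_mul_u, conj_conjSum]

theorem conjSum_mem_center [Fintype G] (a : TwistedGroupAlgebra f) :
    conjSum f a ∈ Subring.center (TwistedGroupAlgebra f) := by
  refine Subring.mem_center_iff.2 fun b => ?_
  have h : LinearMap.mulRight ℂ (conjSum f a) = LinearMap.mulLeft ℂ (conjSum f a) :=
    (basis f).ext fun k => u_mul_conjSum f k a
  exact DFunLike.congr_fun h b

theorem repr_conjSum_one [Fintype G] (a : TwistedGroupAlgebra f) :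
    (basis f).repr (conjSum f a) 1 = Fintype.card G * (basis f).repr a 1 := by
  simp [conjSum, repr_conj_one]

theorem repr_algebraMap (c : ℂ) {g : G} (hg : g ≠ 1) :
    (basis f).repr (algebraMap ℂ (TwistedGroupAlgebra f) c) g = 0 := by
  classical
  rw [Algebra.algebraMap_eq_smul_one, one_def, map_smul, map_smul, Finsupp.smul_apply,
    Finsupp.smul_apply, repr_u, if_neg hg.symm, smul_zero, smul_zero]

/-- If every nontrivial element is non-regular, the twisted group algebra is simple. -/
theorem isSimpleRing_of_forall_exists [Finite G]
    (hf : ∀ g : G, g ≠ 1 → ∃ k, g * k = k * g ∧ f.toFun g k ≠ f.toFun k g) :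
    IsSimpleRing (TwistedGroupAlgebra f) := by
  classical
  have := Fintype.ofFinite G
  refine ⟨⟨fun I => or_iff_not_imp_left.2 fun hI => ?_⟩⟩
  obtain ⟨a, haI, ha⟩ : ∃ a ∈ I, a ≠ 0 := by
    by_contra! h
    exact hI (le_bot_iff.1 fun a ha => (TwoSidedIdeal.mem_bot _).2 (h a ha))
  obtain ⟨g, hg⟩ : ∃ g, (basis f).repr a g ≠ 0 := by
    by_contra! h
    exact ha ((basis f).repr.map_eq_zero_iff.1 (Finsupp.ext h))
  -- Translating moves a nonzero coefficient to the identity, where averaging multiplies it by `|G|`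
  -- and cannot kill it.
  have hb : (basis f).repr (a * u f g⁻¹) 1 ≠ 0 := by
    rw [← mul_inv_cancel g, repr_mul_u]
    exact mul_ne_zero (Units.ne_zero _) hg
  set b := a * u f g⁻¹
  have hbI : b ∈ I := I.mul_mem_right _ _ haI
  have hT : conjSum f b ∈ I :=
    sum_mem fun h _ => I.mul_mem_right _ _ (I.mul_mem_left _ _ hbI)
  -- A central element commutes with `u_k`. For `k` commuting with `x`, comparing coefficients at
  -- `kx` makes the one at `x` vanish unless `f(x, k) = f(k, x)`.
  have hcoeff (x : G) (hx : x ≠ 1) : (basis f).repr (conjSum f b) x = 0 := by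
    obtain ⟨k, hk, hne⟩ := hf x hx
    have h₁ := repr_u_mul f k x (conjSum f b)
    rw [u_mul_conjSum, ← hk, repr_mul_u] at h₁
    by_contra h0
    exact hne (Units.ext (mul_right_cancel₀ h0 h₁))
  have hTu : conjSum f b = (basis f).repr (conjSum f b) 1 • u f 1 := by
    refine (basis f).repr.injective (Finsupp.ext fun x => ?_)
    rw [map_smul, Finsupp.smul_apply, repr_u]
    by_cases hx : x = 1
    · simp [hx]
    · rw [hcoeff x hx, if_neg (Ne.symm hx), smul_zero]
  have hc : (basis f).repr (conjSum f b) 1 ≠ 0 := by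
    rw [repr_conjSum_one]
    exact mul_ne_zero (by simp) hb
  have hu : IsUnit (conjSum f b) := by
    rw [hTu, Algebra.smul_def]
    exact ((IsUnit.mk0 _ hc).map (algebraMap ℂ _)).mul (isUnit_u f 1)
  obtain ⟨v, hv⟩ := hu
  refine (TwoSidedIdeal.one_mem_iff I).1 ?_
  rw [← v.inv_mul, hv]
  exact I.mul_mem_left _ _ hT

/-- In a simple twisted group algebra of a finite group, every central element is a scalar. -/
theorem exists_algebraMap_eq_of_mem_center [Finite G] [IsSimpleRing (TwistedGroupAlgebra f)]
    {t : TwistedGroupAlgebra f} (ht : t ∈ Subring.center (TwistedGroupAlgebra f)) :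
    ∃ c : ℂ, algebraMap ℂ (TwistedGroupAlgebra f) c = t := by
  have : Module.Finite ℂ (TwistedGroupAlgebra f) := Module.Finite.of_basis (basis f)
  obtain ⟨c, hc⟩ := spectrum.nonempty_of_isAlgClosed_of_finiteDimensional ℂ t
  refine ⟨c, ?_⟩
  by_contra hne
  have hmem : algebraMap ℂ (TwistedGroupAlgebra f) c - t ∈
      Subring.center (TwistedGroupAlgebra f) :=
    sub_mem (Subring.mem_center_iff.2 fun b => (Algebra.commutes c b).symm) ht
  -- The centre of a simple ring is a field, so if `c - t` were nonzero it would be invertible,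
  -- contradicting that `c` lies in the spectrum of `t`.
  obtain ⟨d, hd⟩ := (IsSimpleRing.isField_center (TwistedGroupAlgebra f)).mul_inv_cancel
    (a := ⟨_, hmem⟩) (by simpa [Subtype.ext_iff, sub_eq_zero] using hne)
  have hd' : (algebraMap ℂ (TwistedGroupAlgebra f) c - t) * d = 1 := congrArg Subtype.val hd
  refine (spectrum.mem_iff.1 hc) (isUnit_iff_exists.2 ⟨d, hd', ?_⟩)
  rw [← hd']
  exact Subring.mem_center_iff.1 hmem _

/-- In a simple twisted group algebra, every nontrivial element is non-regular. -/
theorem exists_ne_of_isSimpleRing [Finite G] [IsSimpleRing (TwistedGroupAlgebra f)] {g : G}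
    (hg : g ≠ 1) : ∃ k, g * k = k * g ∧ f.toFun g k ≠ f.toFun k g := by
  classical
  have := Fintype.ofFinite G
  by_contra! h
  obtain ⟨c, hc⟩ := exists_algebraMap_eq_of_mem_center f (conjSum_mem_center f (u f g))
  have h0 := repr_algebraMap f c hg
  -- If `g` is regular, every `k` in its centraliser fixes `u_g`. The coefficient of the central
  -- element at `g` is then the order of the centraliser, which is nonzero, whereas a scalar has
  -- coefficient 0 there.
  have hk (k : G) : (basis f).repr (conj f k (u f g)) g = if g * k = k * g then 1 else 0 := by
    have e := repr_conj_mul f k (k⁻¹ * g * k) (u f g)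
    have e' : k * (k⁻¹ * g * k) * k⁻¹ = g := by group
    have hiff : g = k⁻¹ * g * k ↔ g * k = k * g := by
      rw [mul_assoc, eq_inv_mul_iff_mul_eq, eq_comm]
    rw [e', repr_u] at e
    by_cases hgk : g * k = k * g
    · rw [if_pos (hiff.2 hgk), ← hiff.2 hgk, h k hgk] at e
      rw [if_pos hgk]
      exact mul_left_cancel₀ (Units.ne_zero _) e
    · rw [if_neg (mt hiff.1 hgk), mul_zero] at e
      rw [if_neg hgk]
      exact (mul_eq_zero.1 e).resolve_left (Units.ne_zero _)
  rw [hc, conjSum, map_sum, Finsupp.finsetSum_apply, Finset.sum_congr rfl fun k _ => hk k,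
    Finset.sum_boole, Nat.cast_eq_zero, Finset.card_eq_zero] at h0
  exact Finset.notMem_empty (1 : G) (h0 ▸ by simp)

end TwistedGroupAlgebra

/-- A finite group is of central type if and only if, for some 2-cocycle, only the trivial element
is regular. -/
theorem isCentralType_iff {G : Type u} [Group G] : IsCentralType G ↔
    Finite G ∧ ∃ f : TwoCocycle G,
      ∀ g : G, g ≠ 1 → ∃ k, g * k = k * g ∧ f.toFun g k ≠ f.toFun k g :=
  and_congr_right fun _ => exists_congr fun f =>
    ⟨fun _ _ hg => TwistedGroupAlgebra.exists_ne_of_isSimpleRing f hg,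
      TwistedGroupAlgebra.isSimpleRing_of_forall_exists f⟩

/-! ### The commutator pairing of a cocycle. -/

namespace TwistedGroupAlgebra

variable {G : Type u} [Group G] (f : TwoCocycle G)

/-- The commutator pairing of a cocycle, of interest on commuting pairs. -/
def pairing (x y : G) : ℂˣ := f.toFun x y / f.toFun y x

theorem pairing_self (x : G) : pairing f x x = 1 := div_self' _

theorem pairing_symm (x y : G) : pairing f y x = (pairing f x y)⁻¹ := (inv_div _ _).symm

/-- The units lying over a group element, that is, the nonzero multiples of `u_x`. -/
def IsLift (a : (TwistedGroupAlgebra f)ˣ) (x : G) : Prop := ∃ c, a = scalar f c * uUnit f x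

theorem isLift_uUnit (x : G) : IsLift f (uUnit f x) x := ⟨1, by simp⟩

theorem IsLift.mul {a b : (TwistedGroupAlgebra f)ˣ} {x y : G} (ha : IsLift f a x)
    (hb : IsLift f b y) : IsLift f (a * b) (x * y) := by
  obtain ⟨c, rfl⟩ := ha
  obtain ⟨d, rfl⟩ := hb
  refine ⟨c * d * f.toFun x y, ?_⟩
  rw [map_mul, map_mul, mul_assoc _ (scalar f (f.toFun x y)), ← uUnit_mul, mul_assoc, mul_assoc,
    ← mul_assoc (uUnit f x), ← scalar_comm, mul_assoc]

theorem isLift_one_iff (a : (TwistedGroupAlgebra f)ˣ) : IsLift f a 1 ↔ ∃ c, a = scalar f c := by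
  have h : uUnit f 1 = scalar f (f.toFun 1 1) := by
    have := uUnit_mul f 1 1
    rw [mul_one] at this
    exact mul_right_cancel this
  simp only [IsLift, h, ← map_mul]
  exact ⟨fun ⟨c, hc⟩ => ⟨_, hc⟩, fun ⟨c, hc⟩ => ⟨c / f.toFun 1 1, by simpa using hc⟩⟩

theorem IsLift.inv {a : (TwistedGroupAlgebra f)ˣ} {x : G} (ha : IsLift f a x) :
    IsLift f a⁻¹ x⁻¹ := by
  obtain ⟨c, hc⟩ := (isLift_one_iff f _).1
    (mul_inv_cancel x ▸ ha.mul f (isLift_uUnit f x⁻¹) : IsLift f (a * uUnit f x⁻¹) 1)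
  refine ⟨c⁻¹, ?_⟩
  rw [inv_eq_iff_mul_eq_one, ← mul_assoc, ← scalar_comm, mul_assoc, hc, ← map_mul, inv_mul_cancel,
    map_one]

theorem IsLift.mul_comm {a b : (TwistedGroupAlgebra f)ˣ} {x y : G} (ha : IsLift f a x)
    (hb : IsLift f b y) (h : x * y = y * x) : a * b = scalar f (pairing f x y) * (b * a) := by
  have e : uUnit f x * uUnit f y = scalar f (pairing f x y) * (uUnit f y * uUnit f x) := by
    rw [uUnit_mul, uUnit_mul, h, ← mul_assoc, ← map_mul, pairing, div_mul_cancel]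
  obtain ⟨c, rfl⟩ := ha
  obtain ⟨d, rfl⟩ := hb
  calc _ = scalar f c * scalar f d * (uUnit f x * uUnit f y) := by
        rw [mul_assoc, ← mul_assoc (uUnit f x), ← scalar_comm f d (uUnit f x)]
        simp only [mul_assoc]
    _ = scalar f (pairing f x y) * (scalar f c * scalar f d * (uUnit f y * uUnit f x)) := by
        rw [e, ← mul_assoc, ← scalar_comm f (pairing f x y), mul_assoc]
    _ = _ := by
        rw [scalar_comm f c (scalar f d), mul_assoc (scalar f d), ← mul_assoc (scalar f c),
          scalar_comm f c (uUnit f y)]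
        simp only [mul_assoc]

/-- Any lifts compute the pairing, since scalars are central. Identities for `pairing` thus become
manipulations of products of units. -/
theorem IsLift.pairing_eq {a b : (TwistedGroupAlgebra f)ˣ} {x y : G} (ha : IsLift f a x)
    (hb : IsLift f b y) (h : x * y = y * x) {c : ℂˣ} (e : a * b = scalar f c * (b * a)) :
    pairing f x y = c :=
  scalar_injective f (mul_right_cancel ((ha.mul_comm f hb h).symm.trans e))

theorem pairing_mul_right {x y z : G} (hy : x * y = y * x) (hz : x * z = z * x) :
    pairing f x (y * z) = pairing f x y * pairing f x z := by
  have hx := isLift_uUnit f x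
  have hy' := isLift_uUnit f y
  have hz' := isLift_uUnit f z
  refine hx.pairing_eq f (hy'.mul f hz') (by rw [← mul_assoc, hy, mul_assoc, hz, mul_assoc]) ?_
  rw [← mul_assoc, hx.mul_comm f hy' hy, mul_assoc, mul_assoc, hx.mul_comm f hz' hz, map_mul,
    ← mul_assoc (uUnit f y), ← scalar_comm]
  simp only [mul_assoc]

theorem pairing_mul_left {x y z : G} (hx : x * z = z * x) (hy : y * z = z * y) :
    pairing f (x * y) z = pairing f x z * pairing f y z := by
  rw [pairing_symm, pairing_mul_right f hx.symm hy.symm, mul_inv, ← pairing_symm, ← pairing_symm]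

theorem pairing_one_right (x : G) : pairing f x 1 = 1 := by
  rw [pairing, toFun_one_left, toFun_one_right, div_self']

theorem pairing_one_left (x : G) : pairing f 1 x = 1 := by
  rw [pairing, toFun_one_left, toFun_one_right f x, div_self']

theorem pairing_pow_right {x y : G} (h : x * y = y * x) (n : ℕ) :
    pairing f x (y ^ n) = pairing f x y ^ n := by
  induction n with
  | zero => simp [pairing_one_right]
  | succ n ih =>
    rw [pow_succ, pow_succ, pairing_mul_right f ((show Commute x y from h).pow_right n) h, ih]

theorem pairing_pow_left {x y : G} (h : x * y = y * x) (n : ℕ) :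
    pairing f (x ^ n) y = pairing f x y ^ n := by
  rw [pairing_symm, pairing_pow_right f h.symm, pairing_symm f x y, inv_pow, inv_inv]

theorem pairing_conj {x y : G} (h : x * y = y * x) (g : G) :
    pairing f (g * x * g⁻¹) (g * y * g⁻¹) = pairing f x y := by
  have hg := isLift_uUnit f g
  have hx := isLift_uUnit f x
  have hy := isLift_uUnit f y
  refine ((hg.mul f hx).mul f (hg.inv f)).pairing_eq f ((hg.mul f hy).mul f (hg.inv f)) ?_ ?_
  · rw [_root_.conj_mul, _root_.conj_mul, h]
  · rw [_root_.conj_mul, hx.mul_comm f hy h, ← mul_assoc, ← scalar_comm, _root_.conj_mul]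
    simp only [mul_assoc]

/-- If the commutator `z` of `g` and `x` is an involution commuting with both, then the pairings of
`g²` with `x` and of `g` with `x²` determine each other. -/
theorem pairing_sq_mul {g x z : G} (hz : z * z = 1) (hgx : g * x = z * x * g)
    (hgz : g * z = z * g) (hxz : x * z = z * x) :
    pairing f (g ^ 2) x * pairing f x z = pairing f g (x ^ 2) * pairing f g z := by
  have hg := isLift_uUnit f g
  have hx := isLift_uUnit f x
  set U := uUnit f g
  set X := uUnit f x
  set Z := U * X * U⁻¹ * X⁻¹ with hZdef
  have hZ : IsLift f Z z := by
    have := ((hg.mul f hx).mul f (hg.inv f)).mul f (hx.inv f)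
    rwa [hgx, mul_inv_cancel_right, mul_inv_cancel_right] at this
  have hUX : U * X = Z * X * U := by rw [hZdef]; group
  -- The commutator `Z` of the lifts squares to a scalar `c`. Moving `X` past `U²`, or `U` past
  -- `X²`, produces `Z²` together with one exchange of `Z`, so both pairings contain `c`, which then
  -- cancels.
  obtain ⟨c, hc⟩ := (isLift_one_iff f _).1 (hz ▸ hZ.mul f hZ : IsLift f (Z * Z) 1)
  have hUZ := hg.mul_comm f hZ hgz
  have hXZ := hx.mul_comm f hZ hxz
  have e₁ : pairing f (g ^ 2) x = pairing f g z * c := by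
    rw [pow_two]
    refine (hg.mul f hg).pairing_eq f hx ?_ ?_
    · rw [mul_assoc, hgx, mul_assoc, ← mul_assoc g, hgz, mul_assoc, ← mul_assoc g, hgx]
      simp only [← mul_assoc, hz, one_mul]
    · calc U * U * X = (U * Z) * X * U := by rw [mul_assoc, hUX]; simp only [mul_assoc]
        _ = scalar f (pairing f g z) * (Z * (U * X) * U) := by rw [hUZ]; simp only [mul_assoc]
        _ = scalar f (pairing f g z) * (Z * Z * (X * (U * U))) := by
          rw [hUX]; simp only [mul_assoc]
        _ = _ := by rw [hc, map_mul, mul_assoc]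
  have e₂ : pairing f g (x ^ 2) = pairing f x z * c := by
    rw [pow_two]
    refine hg.pairing_eq f (hx.mul f hx) ?_ ?_
    · rw [← mul_assoc, hgx, mul_assoc, hgx, mul_assoc z, ← mul_assoc x, ← mul_assoc x, hxz]
      simp only [← mul_assoc, hz, one_mul]
    · calc U * (X * X) = Z * X * (U * X) := by
            rw [← mul_assoc, ← mul_assoc (Z * X), ← hUX]
        _ = Z * (X * Z) * X * U := by rw [hUX]; simp only [mul_assoc]
        _ = scalar f (pairing f x z) * (Z * Z * (X * X * U)) := by
          rw [hXZ, ← mul_assoc Z, ← scalar_comm]; simp only [mul_assoc]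
        _ = _ := by rw [hc, map_mul]; simp only [mul_assoc]
  rw [e₁, e₂, mul_assoc, mul_comm, mul_comm c]

end TwistedGroupAlgebra

/-! ### Explicit nondegenerate cocycles on the four groups. -/

/-- The integers modulo 4, embedded in `ℂˣ` as the fourth roots of unity. -/
noncomputable def fourthRoot : Multiplicative (ZMod 4) →* ℂˣ :=
  (ZMod.stdAddChar (N := 4)).toMonoidHom.toHomUnits

theorem fourthRoot_injective : Function.Injective fourthRoot := fun _ _ h =>
  Multiplicative.toAdd.injective (ZMod.injective_stdAddChar (N := 4) (congrArg Units.val h))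

theorem isCentralType_of_additive {G : Type u} [Group G] [Finite G] (F : G → G → ZMod 4)
    (hF : ∀ x y z, F x y + F (x * y) z = F y z + F x (y * z))
    (hne : ∀ x, x ≠ 1 → ∃ y, x * y = y * x ∧ F x y ≠ F y x) : IsCentralType G := by
  refine isCentralType_iff.2 ⟨inferInstance,
    ⟨fun x y => fourthRoot (Multiplicative.ofAdd (F x y)), fun x y z => ?_⟩, fun x hx => ?_⟩
  · rw [← map_mul fourthRoot, ← map_mul fourthRoot, ← ofAdd_add, ← ofAdd_add, hF]
  · obtain ⟨y, hxy, h⟩ := hne x hx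
    exact ⟨y, hxy, fun e => h (Multiplicative.ofAdd.injective (fourthRoot_injective e))⟩

theorem IsCentralType.of_mulEquiv {G : Type*} {H : Type*} [Group G] [Group H] (e : G ≃* H)
    (h : IsCentralType H) : IsCentralType G := by
  obtain ⟨_, f, hf⟩ := isCentralType_iff.1 h
  refine isCentralType_iff.2 ⟨Finite.of_equiv H e.symm.toEquiv,
    ⟨fun x y => f.toFun (e x) (e y), fun x y z => ?_⟩, fun x hx => ?_⟩
  · rw [map_mul, map_mul, f.cocycle]
  · obtain ⟨y, hy, hne⟩ := hf (e x) (by simpa using hx)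
    exact ⟨e.symm y, e.injective (by simpa using hy), by simpa using hne⟩

theorem isCentralType_cyc_four_prod : IsCentralType (Cyc 4 × Cyc 4) := by
  refine isCentralType_of_additive (fun x y => x.1.toAdd * y.2.toAdd) (fun x y z => ?_)
    (fun x hx => ?_)
  · simp only [Prod.fst_mul, Prod.snd_mul, toAdd_mul]
    ring
  · by_cases h1 : x.1 = 1
    · refine ⟨(Multiplicative.ofAdd 1, 1), mul_comm _ _, fun h => hx (Prod.ext h1 ?_)⟩
      exact (by simpa using h : 0 = x.2.toAdd).symm
    · refine ⟨(1, Multiplicative.ofAdd 1), mul_comm _ _, fun h => h1 ?_⟩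
      simpa using h

/-- The cocycle is an orthogonal sum of two hyperbolic planes, so each coordinate is detected by the
basis vector of its partner: 0 with 1, and 2 with 3. -/
theorem isCentralType_cyc_two_pow : IsCentralType (Fin 4 → Cyc 2) := by
  let ι : ZMod 2 → ZMod 4 := fun i => if i = 0 then 0 else 2
  have hι : ∀ i j, ι (i + j) = ι i + ι j := by decide
  have hι0 : ∀ i, ι i = 0 → i = 0 := by decide
  have hι1 : ι 0 = 0 := rfl
  refine isCentralType_of_additive
    (fun x y => ι ((x 0).toAdd * (y 1).toAdd + (x 2).toAdd * (y 3).toAdd))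
    (fun x y z => ?_) (fun x hx => ?_)
  · simp only [Pi.mul_apply, toAdd_mul, ← hι]
    congr 1
    ring
  · by_contra! h
    apply hx
    have key (k : Fin 4) (hk : ι (x k).toAdd = 0) : x k = 1 := hι0 _ hk
    have h' (k : Fin 4) := h (Pi.mulSingle k (Multiplicative.ofAdd 1)) (mul_comm _ _)
    funext i
    fin_cases i
    · exact key 0 (by simpa [Pi.mulSingle_apply, hι1] using h' 1)
    · exact key 1 (by simpa [Pi.mulSingle_apply, hι1] using (h' 0).symm)
    · exact key 2 (by simpa [Pi.mulSingle_apply, hι1] using h' 3)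
    · exact key 3 (by simpa [Pi.mulSingle_apply, hι1] using (h' 2).symm)

/-- Triples `a^i b^j c^k` with `c a c⁻¹ = a⁻¹` and `b` central. -/
@[ext] structure DihedralTriple where
  i : ZMod 4
  j : ZMod 2
  k : ZMod 2
deriving DecidableEq, Fintype

namespace DihedralTriple

/-- The sign by which `c^k` acts on the powers of `a`. -/
def sign (k : ZMod 2) : ZMod 4 := if k = 0 then 1 else -1

theorem sign_add : ∀ k l, sign (k + l) = sign k * sign l := by decide

instance : Group DihedralTriple where
  mul x y := ⟨x.i + sign x.k * y.i, x.j + y.j, x.k + y.k⟩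
  one := ⟨0, 0, 0⟩
  inv x := ⟨-(sign x.k * x.i), -x.j, -x.k⟩
  mul_assoc x y z := by
    apply DihedralTriple.ext
    · change x.i + sign x.k * y.i + sign (x.k + y.k) * z.i =
        x.i + sign x.k * (y.i + sign y.k * z.i)
      rw [sign_add]; ring
    · exact add_assoc _ _ _
    · exact add_assoc _ _ _
  one_mul x := by
    apply DihedralTriple.ext
    · change 0 + sign 0 * x.i = x.i
      rw [show sign 0 = 1 from rfl]; ring
    · exact zero_add _
    · exact zero_add _
  mul_one x := by
    apply DihedralTriple.ext
    · change x.i + sign x.k * 0 = x.i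
      ring
    · exact add_zero _
    · exact add_zero _
  inv_mul_cancel x := by
    apply DihedralTriple.ext
    · change -(sign x.k * x.i) + sign (-x.k) * x.i = 0
      rw [ZMod.neg_eq_self_mod_two]; ring
    · exact neg_add_cancel _
    · exact neg_add_cancel _

theorem mul_def (x y : DihedralTriple) :
    x * y = ⟨x.i + sign x.k * y.i, x.j + y.j, x.k + y.k⟩ := rfl

/-- A crossed homomorphism from the `b, c`-part to the characters of `⟨a⟩`. -/
def char (j k : ZMod 2) : ZMod 4 := 2 * j.cast + k.cast

/-- The cocycle evaluates the character attached to the `b, c`-part of `x` at the `a`-part of `y`.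
The crossed homomorphism identity `hchar` is the cocycle condition, and nondegeneracy reflects that
`char` is a bijection onto `ZMod 4`. -/
theorem isCentralType : IsCentralType DihedralTriple := by
  have hchar : ∀ j k l m, char (j + l) (k + m) = char l m + sign m * char j k := by decide
  refine isCentralType_of_additive (fun x y => char x.j x.k * y.i) (fun x y z => ?_) (by decide)
  simp only [mul_def, hchar]
  ring

/-- There is at most one nontrivial square, whereas `HeisenbergTriple` has several; this separates
the two nonabelian groups. -/
theorem sq_eq : ∀ x y : DihedralTriple, x ^ 2 = 1 ∨ y ^ 2 = 1 ∨ x ^ 2 = y ^ 2 := by decide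

end DihedralTriple

/-- Triples `a^i b^j c^k` with `c a c⁻¹ = a b` and `b` central. -/
@[ext] structure HeisenbergTriple where
  i : ZMod 4
  j : ZMod 2
  k : ZMod 2
deriving DecidableEq, Fintype

namespace HeisenbergTriple

/-- Reduction modulo 2. -/
def red : ZMod 4 →+* ZMod 2 := ZMod.castHom (by decide) (ZMod 2)

instance : Group HeisenbergTriple where
  mul x y := ⟨x.i + y.i, x.j + y.j + x.k * red y.i, x.k + y.k⟩
  one := ⟨0, 0, 0⟩
  inv x := ⟨-x.i, -x.j + x.k * red x.i, -x.k⟩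
  mul_assoc x y z := by
    apply HeisenbergTriple.ext
    · exact add_assoc _ _ _
    · change x.j + y.j + x.k * red y.i + z.j + (x.k + y.k) * red z.i =
        x.j + (y.j + z.j + y.k * red z.i) + x.k * red (y.i + z.i)
      rw [map_add]; ring
    · exact add_assoc _ _ _
  one_mul x := by
    apply HeisenbergTriple.ext
    · exact zero_add _
    · change 0 + x.j + 0 * red x.i = x.j
      ring
    · exact zero_add _
  mul_one x := by
    apply HeisenbergTriple.ext
    · exact add_zero _
    · change x.j + 0 + x.k * red 0 = x.j
      rw [map_zero]; ring
    · exact add_zero _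
  inv_mul_cancel x := by
    apply HeisenbergTriple.ext
    · exact neg_add_cancel _
    · change -x.j + x.k * red x.i + x.j + -x.k * red x.i = 0
      ring
    · exact neg_add_cancel _

theorem mul_def (x y : HeisenbergTriple) :
    x * y = ⟨x.i + y.i, x.j + y.j + x.k * red y.i, x.k + y.k⟩ := rfl

/-- The binomial coefficient `i (i - 1) / 2` modulo 2. -/
def choose (i : ZMod 4) : ZMod 2 := (i.val.choose 2 : ℕ)

theorem isCentralType : IsCentralType HeisenbergTriple := by
  have hchoose : ∀ i j, choose (i + j) = choose i + choose j + red i * red j := by decide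
  let ι : ZMod 2 → ZMod 4 := fun i => if i = 0 then 0 else 2
  have hι : ∀ i j, ι (i + j) = ι i + ι j := by decide
  have two : (2 : ZMod 2) = 0 := rfl
  refine isCentralType_of_additive
    -- The factor `y.j + red y.i * y.k` is the exponent of `b` when `y` is rewritten with its power
    -- of `c` in front. It fails to be additive by a product of exponents of `a` and `c`, which the
    -- quadratic term `choose` compensates.
    (fun x y => ι (red x.i * (y.j + red y.i * y.k) + choose x.i * y.k)) (fun x y z => ?_)
    (by decide)
  simp only [mul_def, hchoose, ← hι, map_add]
  congr 1
  ring_nf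
  simp [two]

theorem exists_sq_ne : ∃ x y : HeisenbergTriple, x ^ 2 ≠ 1 ∧ y ^ 2 ≠ 1 ∧ x ^ 2 ≠ y ^ 2 :=
  ⟨⟨1, 0, 0⟩, ⟨1, 0, 1⟩, by decide⟩

end HeisenbergTriple

/-! ### Normal forms, and recognition of the two presented groups. -/

/-- The exponents `p, q` cover both presentations: `ca = a³c` for `GroupIX` and `ca = abc` for
`GroupX`. Moving `c` to the right keeps words in normal form. -/
theorem exists_eq_pow_mul_pow_mul_pow {H : Type*} [Group H] {a b c : H}
    (hgen : Subgroup.closure {a, b, c} = ⊤) (ha : a ^ 4 = 1) (hb : b ^ 2 = 1) (hc : c ^ 2 = 1)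
    (hab : Commute a b) (hbc : Commute b c) {p q : ℕ} (hca : c * a = a ^ p * b ^ q * c) (x : H) :
    ∃ i j k : ℕ, x = a ^ i * b ^ j * c ^ k := by
  have hcai (i : ℕ) : c * a ^ i = a ^ (p * i) * b ^ (q * i) * c := by
    have : SemiconjBy c a (a ^ p * b ^ q) := hca
    have h := this.pow_right i
    rwa [(hab.pow_pow p q).mul_pow, ← pow_mul, ← pow_mul] at h
  have La (x : H) (hx : ∃ i j k : ℕ, x = a ^ i * b ^ j * c ^ k) :
      ∃ i j k : ℕ, a * x = a ^ i * b ^ j * c ^ k := by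
    obtain ⟨i, j, k, rfl⟩ := hx
    exact ⟨i + 1, j, k, by simp only [pow_succ', mul_assoc]⟩
  have Lb (x : H) (hx : ∃ i j k : ℕ, x = a ^ i * b ^ j * c ^ k) :
      ∃ i j k : ℕ, b * x = a ^ i * b ^ j * c ^ k := by
    obtain ⟨i, j, k, rfl⟩ := hx
    refine ⟨i, j + 1, k, ?_⟩
    rw [pow_succ', ← mul_assoc, ← mul_assoc, ← mul_assoc, (hab.pow_left i).eq]
  have Lc (x : H) (hx : ∃ i j k : ℕ, x = a ^ i * b ^ j * c ^ k) :
      ∃ i j k : ℕ, c * x = a ^ i * b ^ j * c ^ k := by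
    obtain ⟨i, j, k, rfl⟩ := hx
    refine ⟨p * i, q * i + j, k + 1, ?_⟩
    rw [← mul_assoc, ← mul_assoc, hcai, pow_succ', mul_assoc _ c, ← (hbc.pow_left j).eq, pow_add]
    simp only [mul_assoc]
  have hai : a⁻¹ = a * a * a := by
    rw [inv_eq_iff_mul_eq_one, ← ha]
    simp only [pow_succ, pow_zero, one_mul, mul_assoc]
  have hbi : b⁻¹ = b := by rw [inv_eq_iff_mul_eq_one, ← hb, pow_two]
  have hci : c⁻¹ = c := by rw [inv_eq_iff_mul_eq_one, ← hc, pow_two]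
  refine Subgroup.closure_induction_left (p := fun x _ => ∃ i j k : ℕ, x = a ^ i * b ^ j * c ^ k)
    ⟨0, 0, 0, by simp⟩ ?_ ?_ (hgen ▸ Subgroup.mem_top x : x ∈ Subgroup.closure {a, b, c})
  · rintro y (rfl | rfl | rfl) z _ hz
    · exact La z hz
    · exact Lb z hz
    · exact Lc z hz
  · rintro y (rfl | rfl | rfl) z _ hz
    · rw [hai, mul_assoc, mul_assoc]
      exact La _ (La _ (La z hz))
    · rw [hbi]
      exact Lb z hz
    · rw [hci]
      exact Lc z hz

theorem finite_and_card_le_sixteen {H : Type*} [Group H] {a b c : H}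
    (hgen : Subgroup.closure {a, b, c} = ⊤) (ha : a ^ 4 = 1) (hb : b ^ 2 = 1) (hc : c ^ 2 = 1)
    (hab : Commute a b) (hbc : Commute b c) {p q : ℕ} (hca : c * a = a ^ p * b ^ q * c) :
    Finite H ∧ Nat.card H ≤ 16 := by
  let φ : Fin 4 × Fin 2 × Fin 2 → H := fun t => a ^ t.1.val * b ^ t.2.1.val * c ^ t.2.2.val
  have hφ : Function.Surjective φ := fun x => by
    obtain ⟨i, j, k, rfl⟩ := exists_eq_pow_mul_pow_mul_pow hgen ha hb hc hab hbc hca x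
    refine ⟨(⟨i % 4, Nat.mod_lt _ (by decide)⟩, ⟨j % 2, Nat.mod_lt _ (by decide)⟩,
      ⟨k % 2, Nat.mod_lt _ (by decide)⟩), ?_⟩
    change a ^ (i % 4) * b ^ (j % 2) * c ^ (k % 2) = _
    rw [← pow_eq_pow_mod i ha, ← pow_eq_pow_mod j hb, ← pow_eq_pow_mod k hc]
  exact ⟨Finite.of_surjective φ hφ, (Nat.card_le_card_of_surjective φ hφ).trans_eq (by simp)⟩

theorem PresentedGroup.closure_three (rels : Set (FreeGroup (Fin 3))) :
    Subgroup.closure {of (rels := rels) 0, of 1, of 2} = ⊤ := by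
  rw [← closure_range_of]
  congr 1
  ext x
  simp [Fin.exists_fin_succ, eq_comm]

/-- A group of order 16 whose generators satisfy the relations of a presented group of order at most
16 is isomorphic to it. -/
theorem PresentedGroup.nonempty_mulEquiv {G : Type*} [Group G] {rels : Set (FreeGroup (Fin 3))}
    (hP : Finite (PresentedGroup rels) ∧ Nat.card (PresentedGroup rels) ≤ 16)
    (hG : Nat.card G = 16) {a b c : G} (h : ∀ r ∈ rels, FreeGroup.lift ![a, b, c] r = 1)
    (hgen : Subgroup.closure {a, b, c} = ⊤) : Nonempty (G ≃* PresentedGroup rels) := by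
  have := hP.1
  let φ : PresentedGroup rels →* G := toGroup h
  have hφ : Function.Surjective φ := by
    rw [← MonoidHom.range_eq_top, eq_top_iff, ← hgen, Subgroup.closure_le]
    rintro _ (rfl | rfl | rfl)
    · exact ⟨of 0, toGroup.of h⟩
    · exact ⟨of 1, toGroup.of h⟩
    · exact ⟨of 2, toGroup.of h⟩
  exact ⟨(MulEquiv.ofBijective φ (hφ.bijective_of_nat_card_le (hG ▸ hP.2))).symm⟩

/-- The defining relations of `GroupIX`, solved for convenience. -/
def RelationsIX {G : Type*} [Group G] (a b c : G) : Prop :=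
  a ^ 4 = 1 ∧ b ^ 2 = 1 ∧ c ^ 2 = 1 ∧ a * b = b * a ∧ b * c = c * b ∧ a * c = a ^ 2 * c * a

/-- The defining relations of `GroupX`, solved for convenience. -/
def RelationsX {G : Type*} [Group G] (a b c : G) : Prop :=
  a ^ 4 = 1 ∧ b ^ 2 = 1 ∧ c ^ 2 = 1 ∧ a * b = b * a ∧ b * c = c * b ∧ a * c = b * c * a

theorem forall_mem_relsIX_iff {G : Type*} [Group G] (φ : FreeGroup (Fin 3) →* G) :
    (∀ r ∈ relsIX, φ r = 1) ↔ RelationsIX (φ (.of 0)) (φ (.of 1)) (φ (.of 2)) := by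
  simp only [relsIX, RelationsIX, Set.mem_insert_iff, Set.mem_singleton_iff, forall_eq_or_imp,
    forall_eq, map_mul, map_pow, map_inv, mul_inv_eq_iff_eq_mul, one_mul]

theorem forall_mem_relsX_iff {G : Type*} [Group G] (φ : FreeGroup (Fin 3) →* G) :
    (∀ r ∈ relsX, φ r = 1) ↔ RelationsX (φ (.of 0)) (φ (.of 1)) (φ (.of 2)) := by
  simp only [relsX, RelationsX, Set.mem_insert_iff, Set.mem_singleton_iff, forall_eq_or_imp,
    forall_eq, map_mul, map_pow, map_inv, mul_inv_eq_iff_eq_mul, one_mul]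

theorem groupIX_card_le : Finite GroupIX ∧ Nat.card GroupIX ≤ 16 := by
  obtain ⟨ha, hb, hc, hab, hbc, hac⟩ := (forall_mem_relsIX_iff (PresentedGroup.mk relsIX)).1
    fun _ => PresentedGroup.one_of_mem
  refine finite_and_card_le_sixteen (PresentedGroup.closure_three _) ha hb hc hab hbc
    (p := 3) (q := 0) ?_
  set a := PresentedGroup.mk relsIX (.of 0)
  set c := PresentedGroup.mk relsIX (.of 2)
  change c * a = a ^ 3 * _ ^ 0 * c
  -- Cancelling one `a` from `ac = a²ca`.
  have h : c = a * c * a :=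
    mul_left_cancel (a := a) (hac.trans (by rw [pow_two]; simp only [mul_assoc]))
  calc c * a = a ^ 4 * c * a := by rw [ha, one_mul]
    _ = a ^ 3 * (a * c * a) := by simp only [pow_succ, mul_assoc]
    _ = _ := by rw [← h, pow_zero, mul_one]

theorem groupX_card_le : Finite GroupX ∧ Nat.card GroupX ≤ 16 := by
  obtain ⟨ha, hb, hc, hab, hbc, hac⟩ := (forall_mem_relsX_iff (PresentedGroup.mk relsX)).1
    fun _ => PresentedGroup.one_of_mem
  refine finite_and_card_le_sixteen (PresentedGroup.closure_three _) ha hb hc hab hbc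
    (p := 1) (q := 1) ?_
  set a := PresentedGroup.mk relsX (.of 0)
  set b := PresentedGroup.mk relsX (.of 1)
  set c := PresentedGroup.mk relsX (.of 2)
  change c * a = a ^ 1 * b ^ 1 * c
  rw [pow_one, pow_one, hab, mul_assoc, hac, ← mul_assoc, ← mul_assoc, ← pow_two, hb, one_mul]

theorem nonempty_mulEquiv_groupIX {G : Type*} [Group G] (hG : Nat.card G = 16) {a b c : G}
    (h : RelationsIX a b c) (hgen : Subgroup.closure {a, b, c} = ⊤) : Nonempty (G ≃* GroupIX) :=
  PresentedGroup.nonempty_mulEquiv groupIX_card_le hG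
    ((forall_mem_relsIX_iff _).2 (by simpa using h)) hgen

theorem nonempty_mulEquiv_groupX {G : Type*} [Group G] (hG : Nat.card G = 16) {a b c : G}
    (h : RelationsX a b c) (hgen : Subgroup.closure {a, b, c} = ⊤) : Nonempty (G ≃* GroupX) :=
  PresentedGroup.nonempty_mulEquiv groupX_card_le hG
    ((forall_mem_relsX_iff _).2 (by simpa using h)) hgen

theorem DihedralTriple.card_eq : Nat.card DihedralTriple = 16 := by
  rw [Nat.card_eq_fintype_card]; rfl

theorem HeisenbergTriple.card_eq : Nat.card HeisenbergTriple = 16 := by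
  rw [Nat.card_eq_fintype_card]; rfl

theorem nonempty_dihedralTriple_mulEquiv : Nonempty (DihedralTriple ≃* GroupIX) := by
  refine nonempty_mulEquiv_groupIX DihedralTriple.card_eq (a := ⟨1, 0, 0⟩) (b := ⟨0, 1, 0⟩)
    (c := ⟨0, 0, 1⟩) (by unfold RelationsIX; decide) (eq_top_iff.2 fun x _ => ?_)
  have hx : ∀ x : DihedralTriple,
      x = ⟨1, 0, 0⟩ ^ x.i.val * ⟨0, 1, 0⟩ ^ x.j.val * ⟨0, 0, 1⟩ ^ x.k.val := by decide
  rw [hx x]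
  exact mul_mem (mul_mem (pow_mem (Subgroup.subset_closure (by simp)) _)
    (pow_mem (Subgroup.subset_closure (by simp)) _)) (pow_mem (Subgroup.subset_closure (by simp)) _)

theorem nonempty_heisenbergTriple_mulEquiv : Nonempty (HeisenbergTriple ≃* GroupX) := by
  refine nonempty_mulEquiv_groupX HeisenbergTriple.card_eq (a := ⟨1, 0, 0⟩) (b := ⟨0, 1, 0⟩)
    (c := ⟨0, 0, 1⟩) (by unfold RelationsX; decide) (eq_top_iff.2 fun x _ => ?_)
  have hx : ∀ x : HeisenbergTriple,
      x = ⟨1, 0, 0⟩ ^ x.i.val * ⟨0, 1, 0⟩ ^ x.j.val * ⟨0, 0, 1⟩ ^ x.k.val := by decide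
  rw [hx x]
  exact mul_mem (mul_mem (pow_mem (Subgroup.subset_closure (by simp)) _)
    (pow_mem (Subgroup.subset_closure (by simp)) _)) (pow_mem (Subgroup.subset_closure (by simp)) _)

theorem groupIX_not_comm : ∃ x y : GroupIX, x * y ≠ y * x := by
  obtain ⟨e⟩ := nonempty_dihedralTriple_mulEquiv
  refine ⟨e ⟨1, 0, 0⟩, e ⟨0, 0, 1⟩, fun h => ?_⟩
  rw [← map_mul, ← map_mul] at h
  exact absurd (e.injective h) (by decide)

theorem groupX_not_comm : ∃ x y : GroupX, x * y ≠ y * x := by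
  obtain ⟨e⟩ := nonempty_heisenbergTriple_mulEquiv
  refine ⟨e ⟨1, 0, 0⟩, e ⟨0, 0, 1⟩, fun h => ?_⟩
  rw [← map_mul, ← map_mul] at h
  exact absurd (e.injective h) (by decide)

theorem isEmpty_cyc_four_prod_mulEquiv : IsEmpty (Cyc 4 × Cyc 4 ≃* (Fin 4 → Cyc 2)) := by
  refine ⟨fun e => ?_⟩
  have h2 : ∀ y : Cyc 2, y ^ 2 = 1 := by decide
  have h : e (.ofAdd 1, 1) ^ 2 = 1 := funext fun i => h2 _
  rw [← map_pow, map_eq_one_iff e e.injective] at h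
  exact absurd h (by decide)

theorem isEmpty_groupIX_mulEquiv_groupX : IsEmpty (GroupIX ≃* GroupX) := by
  refine ⟨fun e => ?_⟩
  obtain ⟨e₁⟩ := nonempty_dihedralTriple_mulEquiv
  obtain ⟨e₂⟩ := nonempty_heisenbergTriple_mulEquiv
  let φ : HeisenbergTriple ≃* DihedralTriple := (e₂.trans e.symm).trans e₁.symm
  obtain ⟨x, y, hx, hy, hxy⟩ := HeisenbergTriple.exists_sq_ne
  have h := DihedralTriple.sq_eq (φ x) (φ y)
  simp only [← map_pow, map_eq_one_iff φ φ.injective, φ.injective.eq_iff] at h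
  tauto

/-- Each of the four groups has order 16 and is of central type. -/
theorem card_and_isCentralType_of_mulEquiv {G : Type u} [Group G]
    (h : Nonempty (G ≃* Cyc 4 × Cyc 4) ∨ Nonempty (G ≃* (Fin 4 → Cyc 2)) ∨
      Nonempty (G ≃* GroupIX) ∨ Nonempty (G ≃* GroupX)) : Nat.card G = 16 ∧ IsCentralType G := by
  obtain ⟨e₁⟩ := nonempty_dihedralTriple_mulEquiv
  obtain ⟨e₂⟩ := nonempty_heisenbergTriple_mulEquiv
  rcases h with ⟨⟨e⟩⟩ | ⟨⟨e⟩⟩ | ⟨⟨e⟩⟩ | ⟨⟨e⟩⟩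
  · exact ⟨(Nat.card_congr e.toEquiv).trans (by simp),
      .of_mulEquiv e isCentralType_cyc_four_prod⟩
  · exact ⟨(Nat.card_congr e.toEquiv).trans (by simp), .of_mulEquiv e isCentralType_cyc_two_pow⟩
  · exact ⟨(Nat.card_congr (e.trans e₁.symm).toEquiv).trans DihedralTriple.card_eq,
      .of_mulEquiv (e.trans e₁.symm) DihedralTriple.isCentralType⟩
  · exact ⟨(Nat.card_congr (e.trans e₂.symm).toEquiv).trans HeisenbergTriple.card_eq,
      .of_mulEquiv (e.trans e₂.symm) HeisenbergTriple.isCentralType⟩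

/-! ### The abelian case. -/

namespace TwistedGroupAlgebra

variable {G : Type u} [Group G] {f : TwoCocycle G}

variable (f) in
/-- Only the trivial element is regular. -/
def Nondegenerate : Prop := ∀ g : G, g ≠ 1 → ∃ k, g * k = k * g ∧ pairing f g k ≠ 1

theorem pairing_pow_four_eq_one (hG : Nat.card G = 16) (hcomm : ∀ x y : G, x * y = y * x)
    (a b : G) : pairing f a b ^ 4 = 1 := by
  have : Finite G := Nat.finite_of_card_ne_zero (by omega)
  set ζ := pairing f a b with hζ
  have h16 : ζ ^ 2 ^ 4 = 1 := by
    rw [hζ, ← pairing_pow_left f (hcomm a b), show 2 ^ 4 = Nat.card G from hG.symm,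
      pow_card_eq_one', pairing_one_left]
  obtain ⟨k, hk, hm⟩ := (Nat.dvd_prime_pow Nat.prime_two).1 (orderOf_dvd_of_pow_eq_one h16)
  -- Pairing with `b` recovers `i` and pairing with `a` recovers `j`, so `(orderOf ζ)² ≤ 16`. As a
  -- power of 2 at most 4, the order divides 4.
  have hinj : Function.Injective
      (fun p : Fin (orderOf ζ) × Fin (orderOf ζ) => a ^ p.1.val * b ^ p.2.val) := by
    rintro ⟨i, j⟩ ⟨i', j'⟩ h
    have h₁ := congrArg (fun t => pairing f t b) h
    have h₂ := congrArg (fun t => pairing f a t) h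
    simp only [pairing_mul_left f (hcomm _ _) (hcomm _ _),
      pairing_mul_right f (hcomm _ _) (hcomm _ _), pairing_pow_left f (hcomm _ _),
      pairing_pow_right f (hcomm _ _), pairing_self, one_pow, mul_one, one_mul, ← hζ] at h₁ h₂
    exact Prod.ext (Fin.ext (pow_injOn_Iio_orderOf i.2 i'.2 h₁))
      (Fin.ext (pow_injOn_Iio_orderOf j.2 j'.2 h₂))
  have hle := Nat.card_le_card_of_injective _ hinj
  rw [hG, Nat.card_prod, Nat.card_fin] at hle
  have h4 : orderOf ζ ≤ 4 := by nlinarith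
  have hk2 : k ≤ 2 := by
    by_contra! h
    have := Nat.pow_le_pow_right (n := 2) (by norm_num) h
    rw [← hm] at this
    omega
  exact orderOf_dvd_iff_pow_eq_one.1 (hm ▸ pow_dvd_pow 2 hk2)

theorem nonempty_mulEquiv_cyc_four_prod (hG : Nat.card G = 16) (hcomm : ∀ x y : G, x * y = y * x)
    (hf : Nondegenerate f) {g : G} (hg : g ^ 2 ≠ 1) : Nonempty (G ≃* Cyc 4 × Cyc 4) := by
  have : Finite G := Nat.finite_of_card_ne_zero (by omega)
  have exp (a : G) : a ^ 4 = 1 := by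
    by_contra h
    obtain ⟨k, -, hk⟩ := hf _ h
    exact hk (by rw [pairing_pow_left f (hcomm _ _), pairing_pow_four_eq_one hG hcomm])
  obtain ⟨b, -, hb⟩ := hf _ hg
  rw [pairing_pow_left f (hcomm _ _)] at hb
  have hord : orderOf (pairing f g b) = 2 ^ (1 + 1) :=
    orderOf_eq_prime_pow (by simpa using hb) (pairing_pow_four_eq_one hG hcomm g b)
  have hadd (a : G) (i j : Cyc 4) :
      a ^ (i * j).toAdd.val = a ^ i.toAdd.val * a ^ j.toAdd.val := by
    rw [toAdd_mul, ZMod.val_add, ← pow_eq_pow_mod _ (exp a), pow_add]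
  let φ : Cyc 4 × Cyc 4 →* G := MonoidHom.mk' (fun p => g ^ p.1.toAdd.val * b ^ p.2.toAdd.val)
    fun p q => by
      rw [Prod.fst_mul, Prod.snd_mul, hadd, hadd, mul_assoc, mul_assoc,
        ← mul_assoc (g ^ q.1.toAdd.val), hcomm (g ^ q.1.toAdd.val), mul_assoc]
  -- Since `β(g, b)` has order exactly 4, pairing with `b` and with `g` recovers both exponents
  -- modulo 4. Equality of orders does the rest.
  have hφ : Function.Injective φ := by
    rintro ⟨i, j⟩ ⟨i', j'⟩ h
    have h₁ := congrArg (fun t => pairing f t b) h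
    have h₂ := congrArg (fun t => pairing f g t) h
    simp only [φ, MonoidHom.mk'_apply, pairing_mul_left f (hcomm _ _) (hcomm _ _),
      pairing_mul_right f (hcomm _ _) (hcomm _ _), pairing_pow_left f (hcomm _ _),
      pairing_pow_right f (hcomm _ _), pairing_self, one_pow, mul_one, one_mul] at h₁ h₂
    have hlt (k : Cyc 4) : k.toAdd.val ∈ Set.Iio (orderOf (pairing f g b)) :=
      hord ▸ ZMod.val_lt k.toAdd
    exact Prod.ext (Multiplicative.toAdd.injective
        (ZMod.val_injective 4 (pow_injOn_Iio_orderOf (hlt i) (hlt i') h₁)))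
      (Multiplicative.toAdd.injective
        (ZMod.val_injective 4 (pow_injOn_Iio_orderOf (hlt j) (hlt j') h₂)))
  exact ⟨(MulEquiv.ofBijective φ (hφ.bijective_of_nat_card_le (by simp [hG]))).symm⟩

end TwistedGroupAlgebra

theorem nonempty_mulEquiv_cyc_two_pow {G : Type u} [Group G] (hG : Nat.card G = 16)
    (hcomm : ∀ x y : G, x * y = y * x) (h : ∀ x : G, x ^ 2 = 1) :
    Nonempty (G ≃* (Fin 4 → Cyc 2)) := by
  have : Finite G := Nat.finite_of_card_ne_zero (by omega)
  let _ : CommGroup G := { ‹Group G› with mul_comm := hcomm }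
  let _ : Module (ZMod 2) (Additive G) := AddCommGroup.zmodModule (n := 2) h
  have hr : Module.finrank (ZMod 2) (Additive G) = 4 := by
    have hc := Module.natCard_eq_pow_finrank (K := ZMod 2) (V := Additive G)
    rw [Nat.card_congr Additive.toMul, hG, Nat.card_zmod] at hc
    exact Nat.pow_right_injective le_rfl hc.symm
  let e := (Module.finBasisOfFinrankEq (ZMod 2) (Additive G) hr).equivFun
  exact ⟨{ toFun := fun g i => .ofAdd (e (.ofMul g) i)
           invFun := fun v => (e.symm fun i => (v i).toAdd).toMul
           left_inv := fun g => e.symm_apply_apply (Additive.ofMul g)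
           right_inv := fun v => e.apply_symm_apply (fun i => (v i).toAdd)
           map_mul' := fun x y => e.map_add (.ofMul x) (.ofMul y) }⟩

/-! ### A central involution and its abelian annihilator of index 2. -/

theorem exists_central_involution {G : Type u} [Group G] (hG : Nat.card G = 16) :
    ∃ z : G, z ≠ 1 ∧ z * z = 1 ∧ ∀ g, g * z = z * g := by
  have : Finite G := Nat.finite_of_card_ne_zero (by omega)
  have : Fact (Nat.Prime 2) := ⟨Nat.prime_two⟩
  have hp : IsPGroup 2 G := IsPGroup.of_card (n := 4) hG
  have : Nontrivial G := Finite.one_lt_card_iff_nontrivial.1 (by omega)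
  have := hp.center_nontrivial
  have hdvd : 2 ∣ Nat.card (Subgroup.center G) := by
    obtain ⟨n, hn⟩ := (IsPGroup.iff_card.1 (hp.to_subgroup (Subgroup.center G)))
    have h1 : 1 < Nat.card (Subgroup.center G) := Finite.one_lt_card
    rw [hn] at h1 ⊢
    exact dvd_pow_self 2 (by rintro rfl; simp at h1)
  obtain ⟨z, hz⟩ := exists_prime_orderOf_dvd_card' 2 hdvd
  refine ⟨z, ?_, ?_, fun g => Subgroup.mem_center_iff.1 z.2 g⟩
  · rintro h
    rw [OneMemClass.coe_eq_one.1 h, orderOf_one] at hz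
    omega
  · have := pow_orderOf_eq_one z
    rw [hz, pow_two] at this
    exact congrArg Subtype.val this

/-- The quotient of `N` by `⟨z⟩` has order 4, hence is abelian, so commutators in `N` lie in `{1,
z}`. -/
theorem commute_or_mul_eq_of_card_eight {G : Type u} [Group G] {N : Subgroup G}
    (hN : Nat.card N = 8) {z : G} (hzN : z ∈ N) (hz1 : z ≠ 1) (hz2 : z * z = 1)
    (hz : ∀ g, g * z = z * g) {a b : G} (ha : a ∈ N) (hb : b ∈ N) : b * a = a * b ∨ b * a = a * b * z := by
  have : Finite N := Nat.finite_of_card_ne_zero (by omega)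
  have : Fact (Nat.Prime 2) := ⟨Nat.prime_two⟩
  let ζ : N := ⟨z, hzN⟩
  have hζ2 : ζ ^ 2 = 1 := Subtype.ext (by simpa [pow_two] using hz2)
  have hζ : orderOf ζ = 2 := orderOf_eq_prime hζ2 (fun h => hz1 (congrArg Subtype.val h))
  have hcen : Subgroup.zpowers ζ ≤ Subgroup.center N :=
    (Subgroup.zpowers_le).2 (Subgroup.mem_center_iff.2 fun g => Subtype.ext (hz g))
  have : (Subgroup.zpowers ζ).Normal := 
    ⟨fun n hn g => by rwa [Subgroup.mem_center_iff.1 (hcen hn) g, mul_inv_cancel_right]⟩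
  have hcard : Nat.card (N ⧸ Subgroup.zpowers ζ) = 2 ^ 2 := by
    have h := Subgroup.card_eq_card_quotient_mul_card_subgroup (Subgroup.zpowers ζ)
    rw [Nat.card_zpowers, hζ, hN] at h
    omega
  have := IsPGroup.isMulCommutative_of_card_eq_prime_sq hcard
  have hq : ((⟨a, ha⟩ * ⟨b, hb⟩ : N) : N ⧸ Subgroup.zpowers ζ) = (⟨b, hb⟩ * ⟨a, ha⟩ : N) :=
    mul_comm' ((⟨a, ha⟩ : N) : N ⧸ Subgroup.zpowers ζ) ((⟨b, hb⟩ : N) : N ⧸ Subgroup.zpowers ζ)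
  obtain ⟨k, hk⟩ := Subgroup.mem_zpowers_iff.1 (QuotientGroup.eq.1 hq)
  rw [eq_inv_mul_iff_mul_eq] at hk
  have hk' : a * b * (ζ ^ k : N) = b * a := congrArg Subtype.val hk
  rcases Int.even_or_odd' k with ⟨m, rfl | rfl⟩
  · rw [zpow_mul, zpow_ofNat, hζ2, one_zpow] at hk'
    exact Or.inl (by simpa using hk'.symm)
  · rw [zpow_add, zpow_mul, zpow_ofNat, hζ2, one_zpow, one_mul, zpow_one] at hk'
    exact Or.inr hk'.symm

/-- A proper subgroup of a group of order 8 has at most four elements. -/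
theorem mem_of_lt_of_card_eight {G : Type u} [Group G] {N H : Subgroup G} (hN : Nat.card N = 8)
    (hHN : H < N) {x z : G} (hz1 : z ≠ 1) (hz2 : z * z = 1) (hx : x ∈ H)
    (hz : z ∈ H) (hx1 : x ≠ 1) (hxz : x ≠ z) {w : G} (hw : w ∈ H) :
    w = 1 ∨ w = z ∨ w = x ∨ w = x * z := by
  have : Finite N := Nat.finite_of_card_ne_zero (by omega)
  have hfin : (H : Set G).Finite := (Set.toFinite (N : Set G)).subset hHN.le
  have hcard : Nat.card H ≤ 4 := by
    have hdvd := Subgroup.card_dvd_of_le hHN.le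
    have hne : Nat.card H ≠ 8 := fun h =>
      hHN.ne (Subgroup.eq_of_le_of_card_ge hHN.le (by omega))
    rw [hN] at hdvd
    have := Nat.le_of_dvd (by omega) hdvd
    interval_cases h : Nat.card H <;> omega
  have hsub : ({1, z, x, x * z} : Set G) ⊆ H := by
    rintro _ (rfl | rfl | rfl | rfl)
    exacts [one_mem _, hz, hx, mul_mem hx hz]
  by_contra! h
  obtain ⟨h1, h2, h3, h4⟩ := h
  classical
  have hxz1 : x * z ≠ 1 := fun e => hxz (mul_right_cancel (e.trans hz2.symm))
  have h5 : Finset.card {w, 1, z, x, x * z} = 5 := by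
    rw [Finset.card_insert_of_notMem (by simp [h1, h2, h3, h4]),
      Finset.card_insert_of_notMem (by simp [hz1.symm, hx1.symm, hxz1.symm]),
      Finset.card_insert_of_notMem (by simp [hxz.symm, hx1]),
      Finset.card_insert_of_notMem (by simp [hz1]), Finset.card_singleton]
  have := Finset.card_le_card (s := {w, 1, z, x, x * z}) (t := hfin.toFinset) (by
    intro y hy
    simp only [Finset.mem_insert, Finset.mem_singleton] at hy
    rw [Set.Finite.mem_toFinset]
    rcases hy with rfl | hy
    · exact hw
    · exact hsub (by simpa using hy))
  rw [← Set.ncard_eq_toFinset_card _ hfin, ← Nat.card_coe_set_eq, h5] at this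
  exact absurd (this.trans hcard) (by norm_num)

namespace TwistedGroupAlgebra

variable {G : Type u} [Group G] {f : TwoCocycle G}

variable (f) in
/-- The character by which a central element pairs with the whole group. -/
def centralPairing {z : G} (hz : ∀ g, g * z = z * g) : G →* ℂˣ :=
  MonoidHom.mk' (pairing f z) fun g h => pairing_mul_right f (hz g).symm (hz h).symm

theorem centralPairing_apply {z : G} (hz : ∀ g, g * z = z * g) (g : G) :
    centralPairing f hz g = pairing f z g := rfl

theorem eq_neg_one_of_sq {ζ : ℂˣ} (h : ζ ^ 2 = 1) (h1 : ζ ≠ 1) : ζ = -1 := by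
  rcases sq_eq_one_iff.1 (by simpa using congrArg Units.val h : (ζ : ℂ) ^ 2 = 1) with h | h
  · exact absurd (Units.ext h) h1
  · exact Units.ext h

theorem neg_one_ne_one_units : (-1 : ℂˣ) ≠ 1 := fun h => by
  have := congrArg Units.val h
  norm_num at this

variable (f) in
/-- A central involution `z` of a group of order 16 whose annihilator `N` under the pairing is an
abelian subgroup of order 8. -/
structure IsPolarization (N : Subgroup G) (z : G) : Prop where
  card : Nat.card G = 16
  card_subgroup : Nat.card N = 8
  ne_one : z ≠ 1
  mul_self : z * z = 1
  central : ∀ g, g * z = z * g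
  mem_iff : ∀ g, g ∈ N ↔ pairing f z g = 1
  comm : ∀ x ∈ N, ∀ y ∈ N, x * y = y * x

theorem pairing_eq_neg_one {z : G} (hz2 : z * z = 1) (hz : ∀ g, g * z = z * g) {g : G}
    (hg : pairing f z g ≠ 1) : pairing f z g = -1 :=
  eq_neg_one_of_sq (by rw [← pairing_pow_left f (hz g).symm, pow_two, hz2, pairing_one_left]) hg

/-- As `z² = 1`, the character `β(z, ·)` takes only the values `±1`, and it is nontrivial by
nondegeneracy. -/
theorem card_ker_centralPairing (hG : Nat.card G = 16) (hf : Nondegenerate f) {z : G} (hz1 : z ≠ 1)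
    (hz2 : z * z = 1) (hz : ∀ g, g * z = z * g) : Nat.card (centralPairing f hz).ker = 8 := by
  have hidx : (centralPairing f hz).ker.index = 2 := by
    obtain ⟨k, -, hk⟩ := hf z hz1
    refine Subgroup.index_eq_two_iff_exists_notMem_and.2 ⟨k, hk, fun b => ?_⟩
    rw [or_iff_not_imp_right]
    intro hb
    rw [MonoidHom.mem_ker, map_mul, centralPairing_apply, centralPairing_apply,
      pairing_eq_neg_one hz2 hz hk, pairing_eq_neg_one hz2 hz hb, neg_mul_neg, one_mul]
  have := (centralPairing f hz).ker.card_mul_index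
  rw [hidx, hG] at this
  omega

/-- If `n, x` in `N` do not commute, then `nxn⁻¹ = xz` and the centraliser of `x` in `N` is `{1, z,
x, xz}`, on which `β(x, ·)` is trivial. An element `g` detecting `x` therefore lies outside `N`, and
computing `β(x, ngn⁻¹)` in two ways gives both `β(x, g)` and its negative. -/
theorem commute_of_mem_ker_centralPairing (hG : Nat.card G = 16) (hf : Nondegenerate f) {z : G}
    (hz1 : z ≠ 1) (hz2 : z * z = 1) (hz : ∀ g, g * z = z * g) {x n : G}
    (hx : x ∈ (centralPairing f hz).ker) (hn : n ∈ (centralPairing f hz).ker) :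
    n * x = x * n := by
  set N := (centralPairing f hz).ker with hNdef
  have hN : Nat.card N = 8 := card_ker_centralPairing hG hf hz1 hz2 hz
  have hzN : z ∈ N := pairing_self f z
  by_contra hnx
  have hnxz : n * x = x * n * z :=
    (commute_or_mul_eq_of_card_eight hN hzN hz1 hz2 hz hx hn).resolve_left hnx
  have hx1 : x ≠ 1 := by rintro rfl; simp at hnx
  have hxz : x ≠ z := by rintro rfl; exact hnx (hz n)
  have hconj : n * x * n⁻¹ = x * z := by
    rw [hnxz, mul_assoc x, hz, ← mul_assoc, mul_inv_cancel_right]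
  have hzx : pairing f x z = 1 := by rw [pairing_symm, show pairing f z x = 1 from hx, inv_one]
  have hlt : N ⊓ Subgroup.centralizer {x} < N :=
    lt_of_le_of_ne inf_le_left fun h => hnx <| (Subgroup.mem_centralizer_singleton_iff.1
      (h.ge hn).2)
  have hK {w : G} (hwN : w ∈ N) (hwx : w * x = x * w) : pairing f x w = 1 := by
    rcases mem_of_lt_of_card_eight hN hlt hz1 hz2 (x := x)
      ⟨hx, Subgroup.mem_centralizer_singleton_iff.2 rfl⟩
      ⟨hzN, Subgroup.mem_centralizer_singleton_iff.2 (hz x).symm⟩ hx1 hxz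
      ⟨hwN, Subgroup.mem_centralizer_singleton_iff.2 hwx⟩ with rfl | rfl | rfl | rfl
    · exact pairing_one_right f x
    · exact hzx
    · exact pairing_self f _
    · rw [pairing_mul_right f rfl (hz x), hzx, pairing_self, one_mul]
  obtain ⟨g, hxg, hg⟩ := hf x hx1
  have hgN : g ∉ N := fun h => hg (hK h hxg.symm)
  have hzg : pairing f z g = -1 := pairing_eq_neg_one hz2 hz hgN
  have hxg' : Commute x (n * g * n⁻¹) := by
    have h : Commute (n * x * n⁻¹) (n * g * n⁻¹) := by
      change _ * _ = _ * _
      rw [_root_.conj_mul, _root_.conj_mul, hxg]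
    rw [hconj] at h
    have hzc : Commute z⁻¹ (n * g * n⁻¹) := (show Commute z _ from (hz _).symm).inv_left
    simpa using h.mul_left hzc
  have hcN : n * g * n⁻¹ * g⁻¹ ∈ N := by
    rw [hNdef, MonoidHom.mem_ker, map_mul, map_mul, map_mul, map_inv, map_inv, mul_inv_cancel_comm,
      mul_inv_cancel]
  have hcx : Commute x (n * g * n⁻¹ * g⁻¹) :=
    hxg'.mul_right (show Commute x g from hxg).inv_right
  -- The quotient of `ngn⁻¹` by `g` lies in `N` and commutes with `x`, so it pairs trivially with
  -- `x`.
  have e₁ : pairing f x (n * g * n⁻¹) = pairing f x g := by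
    have := pairing_mul_right f hcx.eq hxg
    rwa [inv_mul_cancel_right, hK hcN hcx.eq.symm, one_mul] at this
  -- Conjugation invariance gives `β(xz, ngn⁻¹) = β(x, g)`, and `z` contributes the sign.
  have e₂ : pairing f x (n * g * n⁻¹) = - pairing f x g := by
    have h := pairing_conj f hxg n
    rw [hconj, pairing_mul_left f hxg'.eq (hz _).symm] at h
    have h' : pairing f z (n * g * n⁻¹) = -1 := by
      rw [← centralPairing_apply hz, map_mul, map_mul, map_inv, mul_inv_cancel_comm]
      exact hzg
    rw [h', mul_neg, mul_one] at h
    rw [← h, neg_neg]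
  rw [e₁] at e₂
  exact (Units.ne_zero _ : ((pairing f x g : ℂˣ) : ℂ) ≠ 0)
    (self_eq_neg.1 (by simpa using congrArg Units.val e₂))

theorem exists_isPolarization (hG : Nat.card G = 16) (hf : Nondegenerate f) :
    ∃ N z, IsPolarization f N z := by
  obtain ⟨z, hz1, hz2, hz⟩ := exists_central_involution hG
  exact ⟨(centralPairing f hz).ker, z, hG, card_ker_centralPairing hG hf hz1 hz2 hz, hz1, hz2, hz,
    fun _ => Iff.rfl, fun x hx y hy => commute_of_mem_ker_centralPairing hG hf hz1 hz2 hz hy hx⟩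

end TwistedGroupAlgebra

/-! ### The nonabelian groups, from the action of an outer element on `N`. -/

namespace TwistedGroupAlgebra

namespace IsPolarization

variable {G : Type u} [Group G] {f : TwoCocycle G} {N : Subgroup G} {z : G}
  (P : IsPolarization f N z)

include P

theorem z_mem : z ∈ N := (P.mem_iff z).2 (pairing_self f z)

theorem pairing_of_notMem {g : G} (hg : g ∉ N) : pairing f z g = -1 :=
  pairing_eq_neg_one P.mul_self P.central (mt (P.mem_iff g).2 hg)

theorem pairing_of_notMem' {g : G} (hg : g ∉ N) : pairing f g z = -1 := by
  rw [pairing_symm, P.pairing_of_notMem hg, inv_neg, inv_one]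

theorem pairing_of_mem {g : G} (hg : g ∈ N) : pairing f g z = 1 := by
  rw [pairing_symm, (P.mem_iff g).1 hg, inv_one]

theorem mul_mem_of_notMem {g h : G} (hg : g ∉ N) (hh : h ∉ N) : g * h ∈ N := by
  rw [P.mem_iff, pairing_mul_right f (P.central g).symm (P.central h).symm, P.pairing_of_notMem hg,
    P.pairing_of_notMem hh, neg_mul_neg, one_mul]

theorem sq_mem {g : G} (hg : g ∉ N) : g ^ 2 ∈ N := pow_two g ▸ P.mul_mem_of_notMem hg hg

theorem conj_mem {x : G} (hx : x ∈ N) (g : G) : g * x * g⁻¹ ∈ N := by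
  rw [P.mem_iff, ← centralPairing_apply P.central, map_mul, map_mul, map_inv, mul_inv_cancel_comm]
  exact (P.mem_iff x).1 hx

/-- The annihilator of `x` in `N` is a proper subgroup, as it misses `y`, so it has at most four
elements. The four listed ones already belong to it and are distinct. -/
theorem eq_of_pairing_eq_one {x y w : G} (hx : x ∈ N) (hy : y ∈ N) (hxy : pairing f x y ≠ 1)
    (hw : w ∈ N) (hxw : pairing f x w = 1) : w = 1 ∨ w = z ∨ w = x ∨ w = x * z := by
  let H : Subgroup G :=
    { carrier := {w | w ∈ N ∧ pairing f x w = 1}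
      one_mem' := ⟨one_mem _, pairing_one_right f x⟩
      mul_mem' := fun {a b} ha hb => ⟨mul_mem ha.1 hb.1, by
        rw [pairing_mul_right f (P.comm _ hx _ ha.1) (P.comm _ hx _ hb.1), ha.2, hb.2, one_mul]⟩
      inv_mem' := fun {a} ha => ⟨inv_mem ha.1, by
        have h := pairing_mul_right f (P.comm _ hx _ ha.1) (P.comm _ hx _ (inv_mem ha.1))
        rwa [mul_inv_cancel, pairing_one_right, ha.2, one_mul, eq_comm] at h⟩ }
  have hlt : H < N := lt_of_le_of_ne (fun _ h => h.1) fun h => hxy (h.ge hy).2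
  refine mem_of_lt_of_card_eight P.card_subgroup hlt P.ne_one P.mul_self (x := x)
    ⟨hx, pairing_self f x⟩ ⟨P.z_mem, P.pairing_of_mem hx⟩ ?_ ?_ ⟨hw, hxw⟩
  · rintro rfl
    exact hxy (pairing_one_left f y)
  · rintro rfl
    exact hxy ((P.mem_iff y).1 hy)

/-- The square of `x` annihilates `x`. If it were `x` or `xz`, then `x` would be `1` or `z` and
would pair trivially with `y`. -/
theorem mul_self_eq {x y : G} (hx : x ∈ N) (hy : y ∈ N) (hxy : pairing f x y ≠ 1) :
    x * x = 1 ∨ x * x = z := by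
  rcases P.eq_of_pairing_eq_one hx hy hxy (mul_mem hx hx)
    (by rw [pairing_mul_right f rfl rfl, pairing_self, one_mul]) with h | h | h | h
  · exact Or.inl h
  · exact Or.inr h
  · exact absurd (by rw [mul_eq_left.1 h, pairing_one_left]) hxy
  · exact absurd (by rw [mul_left_cancel h, (P.mem_iff y).1 hy]) hxy

theorem pairing_eq_neg_one {x y : G} (hx : x ∈ N) (hy : y ∈ N) (hxy : pairing f x y ≠ 1) :
    pairing f x y = -1 := by
  refine eq_neg_one_of_sq ?_ hxy
  rw [← pairing_pow_left f (P.comm _ hx _ hy), pow_two]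
  rcases P.mul_self_eq hx hy hxy with h | h
  · rw [h, pairing_one_left]
  · rw [h, (P.mem_iff y).1 hy]

theorem mul_eq_of_pairing_ne_one {x y w : G} (hx : x ∈ N) (hy : y ∈ N) (hxy : pairing f x y ≠ 1)
    (hw : w ∈ N) (hxw : pairing f x w ≠ 1) :
    y * w = 1 ∨ y * w = z ∨ y * w = x ∨ y * w = x * z := by
  refine P.eq_of_pairing_eq_one hx hy hxy (mul_mem hy hw) ?_
  rw [pairing_mul_right f (P.comm _ hx _ hy) (P.comm _ hx _ hw), P.pairing_eq_neg_one hx hy hxy,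
    P.pairing_eq_neg_one hx hw hxw, neg_mul_neg, one_mul]

/-- The annihilator of `x` in `N` and its coset by `y` exhaust `N`, and `g` supplies the other coset
of `N`. -/
theorem eq_top {x y g : G} (hx : x ∈ N) (hy : y ∈ N) (hxy : pairing f x y ≠ 1) (hg : g ∉ N)
    {C : Subgroup G} (hxC : x ∈ C) (hyC : y ∈ C) (hzC : z ∈ C) (hgC : g ∈ C) : C = ⊤ := by
  have aux {w : G} (h : w = 1 ∨ w = z ∨ w = x ∨ w = x * z) : w ∈ C := by
    rcases h with rfl | rfl | rfl | rfl
    exacts [one_mem _, hzC, hxC, mul_mem hxC hzC]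
  have hNC {w : G} (hw : w ∈ N) : w ∈ C := by
    by_cases hxw : pairing f x w = 1
    · exact aux (P.eq_of_pairing_eq_one hx hy hxy hw hxw)
    · exact (Subgroup.mul_mem_cancel_left C hyC).1
        (aux (P.mul_eq_of_pairing_ne_one hx hy hxy hw hxw))
  refine eq_top_iff.2 fun w _ => ?_
  by_cases hw : w ∈ N
  · exact hNC hw
  · exact (Subgroup.mul_mem_cancel_left C hgC).1 (hNC (P.mul_mem_of_notMem hg hw))

/-- The case of an action of `g` on `N` that is trivial modulo `z`, normalised. -/
theorem nonempty_of_conj_eq_mul_of_pairing_eq_one {x y g : G} (hx : x ∈ N) (hy : y ∈ N)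
    (hxy : pairing f x y ≠ 1) (hg : g ∉ N) (hgx : g * x = z * x * g) (hgy : g * y = y * g)
    (hyg : pairing f y g = 1) (hy2 : y * y = 1) :
    Nonempty (G ≃* GroupIX) ∨ Nonempty (G ≃* GroupX) := by
  have hyx : pairing f y x ≠ 1 := by rwa [pairing_symm, inv_ne_one]
  -- The square annihilates `y`, so it lies in `{1, z, y, yz}`. Since `β(g², g) = 1` while `β(z, g)
  -- = -1`, the two options containing `z` are excluded.
  have hgg : g ^ 2 = 1 ∨ g ^ 2 = y := by
    have h := P.eq_of_pairing_eq_one hy hx hyx (P.sq_mem hg)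
      (by rw [pairing_pow_right f hgy.symm, hyg, one_pow])
    have h1 : pairing f (g ^ 2) g = 1 := by rw [pairing_pow_left f rfl, pairing_self, one_pow]
    rcases h with h | h | h | h
    · exact Or.inl h
    · rw [h, P.pairing_of_notMem hg] at h1
      exact absurd h1 neg_one_ne_one_units
    · exact Or.inr h
    · rw [h, pairing_mul_left f hgy.symm (P.central g).symm, P.pairing_of_notMem hg, hyg,
        one_mul] at h1
      exact absurd h1 neg_one_ne_one_units
  -- This becomes `β(g², x) = -β(g, x²)`, which ties the value of `g²` to that of `x²`.
  have L := pairing_sq_mul f P.mul_self hgx (P.central g) (P.central x)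
  rw [P.pairing_of_mem hx, mul_one, P.pairing_of_notMem' hg] at L
  rcases P.mul_self_eq hx hy hxy with hx2 | hx2
  · rw [pow_two x, hx2, pairing_one_right, one_mul] at L
    have hgy2 : g ^ 2 = y := hgg.resolve_left fun h => by
      rw [h, pairing_one_left] at L
      exact neg_one_ne_one_units L.symm
    refine Or.inr (nonempty_mulEquiv_groupX P.card (a := g) (b := z) (c := x)
      ⟨?_, ?_, ?_, P.central g, (P.central x).symm, hgx⟩
      (P.eq_top hx hy hxy hg ?_ ?_ ?_ ?_))
    · rw [show 4 = 2 * 2 from rfl, pow_mul, hgy2, pow_two, hy2]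
    · rw [pow_two, P.mul_self]
    · rw [pow_two, hx2]
    · exact Subgroup.subset_closure (by simp)
    · exact hgy2 ▸ pow_mem (Subgroup.subset_closure (by simp)) 2
    · exact Subgroup.subset_closure (by simp)
    · exact Subgroup.subset_closure (by simp)
  · rw [pow_two x, hx2, P.pairing_of_notMem' hg, neg_mul_neg, one_mul] at L
    have hg2 : g ^ 2 = 1 := hgg.resolve_right fun h => hyx (by rwa [h] at L)
    refine Or.inl (nonempty_mulEquiv_groupIX P.card (a := x) (b := y) (c := g)
      ⟨?_, ?_, hg2, P.comm _ hx _ hy, hgy.symm, ?_⟩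
      (P.eq_top hx hy hxy hg ?_ ?_ ?_ ?_))
    · rw [show 4 = 2 * 2 from rfl, pow_mul, pow_two x, hx2, pow_two, P.mul_self]
    · rw [pow_two, hy2]
    · rw [pow_two, hx2, mul_assoc z, hgx, ← mul_assoc, ← mul_assoc, P.mul_self, one_mul]
    · exact Subgroup.subset_closure (by simp)
    · exact Subgroup.subset_closure (by simp)
    · exact hx2 ▸ mul_mem (Subgroup.subset_closure (by simp)) (Subgroup.subset_closure (by simp))
    · exact Subgroup.subset_closure (by simp)

/-- The case of an action of `g` on `N` that is trivial modulo `z`. -/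
theorem nonempty_of_conj_eq_mul {x y g : G} (hx : x ∈ N) (hy : y ∈ N)
    (hxy : pairing f x y ≠ 1) (hg : g ∉ N) (hgx : g * x = z * x * g) (hgy : g * y = y * g) :
    Nonempty (G ≃* GroupIX) ∨ Nonempty (G ≃* GroupX) := by
  have hyx : pairing f y x ≠ 1 := by rwa [pairing_symm, inv_ne_one]
  have hygg : pairing f y (g ^ 2) = 1 := by
    -- Otherwise `x g²` lies in `{1, z, y, yz}`, all of which commute with `g`; then `g` would
    -- commute with `x`.
    by_contra h
    have hcomm {w : G} (hw : w = 1 ∨ w = z ∨ w = y ∨ w = y * z) : Commute g w := by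
      have hz : Commute g z := P.central g
      rcases hw with rfl | rfl | rfl | rfl
      exacts [Commute.one_right g, hz, hgy, Commute.mul_right hgy hz]
    have h1 := hcomm (P.mul_eq_of_pairing_ne_one hy hx hyx (P.sq_mem hg) h)
    have h2 : Commute g x := by
      simpa using h1.mul_right ((Commute.refl g).pow_right 2).inv_right
    rw [h2.eq, mul_left_inj, eq_comm, mul_eq_right] at hgx
    exact P.ne_one hgx
  have hyg2 : pairing f y g ^ 2 = 1 := by rw [← pairing_pow_right f hgy.symm, hygg]
  have hy2 : y * y = 1 := (P.mul_self_eq hy hx hyx).resolve_right fun h => by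
    rw [← pairing_pow_left f hgy.symm, pow_two, h, P.pairing_of_notMem hg] at hyg2
    exact neg_one_ne_one_units hyg2
  by_cases hyg : pairing f y g = 1
  · exact P.nonempty_of_conj_eq_mul_of_pairing_eq_one hx hy hxy hg hgx hgy hyg hy2
  -- Passing from `g` to `xg` multiplies `β(y, g) = -1` by `β(y, x) = -1`.
  · have hxg : x * g ∉ N := fun h => hg ((Subgroup.mul_mem_cancel_left N hx).1 h)
    refine P.nonempty_of_conj_eq_mul_of_pairing_eq_one (g := x * g) hx hy hxy hxg ?_ ?_ ?_ hy2
    · rw [mul_assoc, hgx, ← mul_assoc, ← mul_assoc, P.central x]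
      simp only [mul_assoc]
    · rw [mul_assoc, hgy, ← mul_assoc, P.comm _ hx _ hy, mul_assoc]
    · rw [pairing_mul_right f (P.comm _ hy _ hx) hgy.symm, P.pairing_eq_neg_one hy hx hyx,
        eq_neg_one_of_sq hyg2 hyg, neg_mul_neg, one_mul]

theorem eq_top_of_conj {x y g : G} (hx : x ∈ N) (hy : y ∈ N) (hxy : pairing f x y ≠ 1) (hg : g ∉ N)
    (hgx : g * x = y * g) {C : Subgroup G} (hxC : x ∈ C) (hzC : z ∈ C) (hgC : g ∈ C) : C = ⊤ :=
  P.eq_top hx hy hxy hg hxC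
    ((Subgroup.mul_mem_cancel_right C hgC).1 (hgx ▸ mul_mem hgC hxC)) hzC hgC

/-- The case of an action of `g` on `N` that is nontrivial modulo `z`, normalised. -/
theorem nonempty_of_conj_eq_of_sq_eq {x y g : G} (hx : x ∈ N) (hy : y ∈ N)
    (hxy : pairing f x y ≠ 1) (hg : g ∉ N) (hgx : g * x = y * g) (hgy : g * y = x * g)
    (hyx2 : y * y = x * x) (hg2 : g * g = 1 ∨ g * g = x * y) :
    Nonempty (G ≃* GroupIX) ∨ Nonempty (G ≃* GroupX) := by
  have hcomm : y * x = x * y := P.comm _ hy _ hx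
  have hzx : x * z = z * x := P.central x
  have hx4 : x * x * (x * x) = 1 := by
    rcases P.mul_self_eq hx hy hxy with h | h
    · rw [h, one_mul]
    · rw [h, P.mul_self]
  have ht2 : x * y * (x * y) = 1 := by
    rw [← hx4]
    nth_rw 2 [← hyx2]
    rw [mul_assoc, ← mul_assoc y, hcomm]
    simp only [mul_assoc]
  have hgt : g * (x * y) = x * y * g := by
    rw [← mul_assoc, hgx, mul_assoc, hgy, ← mul_assoc, hcomm]
  rcases P.mul_self_eq hx hy hxy with hx2 | hx2
  · left
    rcases hg2 with hg2 | hg2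
    -- Here `g` is an involution, so the generator of order 4 is taken to be `gx`, whose square is
    -- `yx`.
    · have ha2 : g * x * (g * x) = x * y := by
        rw [← hcomm]
        nth_rw 1 [hgx]
        rw [mul_assoc, ← mul_assoc g, hg2, one_mul]
      refine nonempty_mulEquiv_groupIX P.card (a := g * x) (b := z) (c := x)
        ⟨?_, ?_, ?_, P.central _, hzx.symm, ?_⟩
        (P.eq_top_of_conj hx hy hxy hg hgx ?_ ?_ ?_)
      · rw [show 4 = 2 * 2 from rfl, pow_mul, pow_two, pow_two, ha2, ht2]
      · rw [pow_two, P.mul_self]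
      · rw [pow_two, hx2]
      · rw [pow_two, ha2, hgx, mul_assoc (x * y), ← mul_assoc x y g, ← mul_assoc (x * y), ht2,
          one_mul, mul_assoc y, hgx, ← mul_assoc, hyx2, hx2, one_mul]
      · exact Subgroup.subset_closure (by simp)
      · exact Subgroup.subset_closure (by simp)
      · exact (Subgroup.mul_mem_cancel_right _ (Subgroup.subset_closure (by simp))).1
          (Subgroup.subset_closure (by simp) : g * x ∈ Subgroup.closure {g * x, z, x})
    · refine nonempty_mulEquiv_groupIX P.card (a := g) (b := z) (c := x)
        ⟨?_, ?_, ?_, P.central _, hzx.symm, ?_⟩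
        (P.eq_top_of_conj hx hy hxy hg hgx ?_ ?_ ?_)
      · rw [show 4 = 2 * 2 from rfl, pow_mul, pow_two, pow_two, hg2, ht2]
      · rw [pow_two, P.mul_self]
      · rw [pow_two, hx2]
      · rw [pow_two, hg2, ← hcomm, mul_assoc y, hx2, mul_one, hgx]
      · exact Subgroup.subset_closure (by simp)
      · exact Subgroup.subset_closure (by simp)
      · exact Subgroup.subset_closure (by simp)
  · right
    have hb2 : x * y * z * (x * y * z) = 1 := by
      rw [mul_assoc, ← P.central, mul_assoc (x * y), P.mul_self, mul_one, ht2]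
    have hxb : x * (x * y * z) = x * y * z * x :=
      P.comm _ hx _ (mul_mem (mul_mem hx hy) P.z_mem)
    have hgb : x * y * z * g = g * (x * y * z) := by
      rw [mul_assoc, ← P.central, ← mul_assoc, ← hgt, mul_assoc]
    -- With `y² = z`, the element `xyz` equals `xy⁻¹`, which is the commutator of `x` and `g`.
    have hby : x * y * z * y = x := by
      rw [mul_assoc, ← P.central y, mul_assoc, ← mul_assoc y, hyx2, hx2, P.mul_self, mul_one]
    rcases hg2 with hg2 | hg2
    · refine nonempty_mulEquiv_groupX P.card (a := x) (b := x * y * z) (c := g)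
        ⟨?_, ?_, ?_, hxb, hgb, ?_⟩
        (P.eq_top_of_conj hx hy hxy hg hgx ?_ ?_ ?_)
      · rw [show 4 = 2 * 2 from rfl, pow_mul, pow_two, pow_two, hx4]
      · rw [pow_two, hb2]
      · rw [pow_two, hg2]
      · rw [mul_assoc _ g, hgx, ← mul_assoc, hby]
      · exact Subgroup.subset_closure (by simp)
      · exact hx2 ▸ mul_mem (Subgroup.subset_closure (by simp))
          (Subgroup.subset_closure (by simp))
      · exact Subgroup.subset_closure (by simp)
    -- Now `g² = xy`, and `xg` is an involution because `(xg)² = xy g² = (xy)²`.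
    · refine nonempty_mulEquiv_groupX P.card (a := x) (b := x * y * z) (c := x * g)
        ⟨?_, ?_, ?_, hxb, ?_, ?_⟩
        (P.eq_top_of_conj hx hy hxy hg hgx ?_ ?_ ?_)
      · rw [show 4 = 2 * 2 from rfl, pow_mul, pow_two, pow_two, hx4]
      · rw [pow_two, hb2]
      · rw [pow_two, mul_assoc, ← mul_assoc g, hgx, mul_assoc y, hg2, ← mul_assoc, ht2]
      · rw [← mul_assoc, ← hxb, mul_assoc, hgb, ← mul_assoc x g]
      · calc x * (x * g) = x * y * z * y * (x * g) := by rw [hby]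
          _ = x * y * z * (y * x) * g := by simp only [mul_assoc]
          _ = x * y * z * (x * g) * x := by
            rw [hcomm, mul_assoc _ _ x, mul_assoc x g x, hgx]
            simp only [mul_assoc]
      · exact Subgroup.subset_closure (by simp)
      · exact hx2 ▸ mul_mem (Subgroup.subset_closure (by simp))
          (Subgroup.subset_closure (by simp))
      · exact (Subgroup.mul_mem_cancel_left _ (Subgroup.subset_closure (by simp))).1
          (Subgroup.subset_closure (by simp) : x * g ∈ Subgroup.closure {x, x * y * z, x * g})

/-- The case of an action of `g` on `N` that is nontrivial modulo `z`. -/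
theorem nonempty_of_pairing_conj_ne_one {x g : G} (hx : x ∈ N) (hg : g ∉ N)
    (hxg : pairing f x (g * x * g⁻¹) ≠ 1) :
    Nonempty (G ≃* GroupIX) ∨ Nonempty (G ≃* GroupX) := by
  have hy : g * x * g⁻¹ ∈ N := P.conj_mem hx g
  have hgx : g * x = g * x * g⁻¹ * g := (inv_mul_cancel_right _ _).symm
  have hyx2 : g * x * g⁻¹ * (g * x * g⁻¹) = x * x := by
    rw [_root_.conj_mul]
    rcases P.mul_self_eq hx hy hxg with h | h
    · rw [h, mul_one, mul_inv_cancel]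
    · rw [h, P.central, mul_inv_cancel_right]
  -- Since `g²` lies in the abelian `N`, conjugation by `g` is an involution on `N` and exchanges
  -- `x` with its conjugate.
  have hgy : g * (g * x * g⁻¹) = x * g := by
    have h := P.comm _ (P.sq_mem hg) _ hx
    rw [pow_two] at h
    rw [← mul_assoc, ← mul_assoc, h, ← mul_assoc, mul_inv_cancel_right]
  generalize g * x * g⁻¹ = y at hxg hy hgx hyx2 hgy
  have hcomm : y * x = x * y := P.comm _ hy _ hx
  have ht : x * y ∈ N := mul_mem hx hy
  have hyx : pairing f y x = -1 :=
    P.pairing_eq_neg_one hy hx (by rwa [pairing_symm, inv_ne_one])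
  have htx : pairing f (x * y) x = -1 := by
    rw [pairing_mul_left f rfl hcomm, pairing_self, one_mul, hyx]
  have htx1 : pairing f (x * y) x ≠ 1 := htx ▸ neg_one_ne_one_units
  have hgt : x * y * g = g * (x * y) := by
    rw [← mul_assoc g, hgx, mul_assoc y, hgy, ← mul_assoc, hcomm]
  have htg2 : pairing f (x * y) g ^ 2 = 1 := by
    have hx4 : x * x * (x * x) = 1 := by
      rcases P.mul_self_eq hx hy hxg with h | h
      · rw [h, one_mul]
      · rw [h, P.mul_self]
    have ht2 : x * y * (x * y) = 1 := by
      rw [← hx4]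
      nth_rw 2 [← hyx2]
      rw [mul_assoc, ← mul_assoc y, hcomm]
      simp only [mul_assoc]
    rw [← pairing_pow_left f hgt, pow_two, ht2, pairing_one_left]
  have key {h : G} (hh : h ∉ N) (hht : x * y * h = h * (x * y)) (hth : pairing f (x * y) h = 1) :
      h * h = 1 ∨ h * h = x * y := by
    have h1 : pairing f (h * h) h = 1 := by rw [pairing_mul_left f rfl rfl, pairing_self, one_mul]
    rcases P.eq_of_pairing_eq_one ht hx htx1 (P.mul_mem_of_notMem hh hh)
      (by rw [pairing_mul_right f hht hht, hth, one_mul]) with e | e | e | e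
    · exact Or.inl e
    · rw [e, P.pairing_of_notMem hh] at h1
      exact absurd h1 neg_one_ne_one_units
    · exact Or.inr e
    · rw [e, pairing_mul_left f hht (P.central h).symm, hth, P.pairing_of_notMem hh, one_mul] at h1
      exact absurd h1 neg_one_ne_one_units
  by_cases htg : pairing f (x * y) g = 1
  · exact P.nonempty_of_conj_eq_of_sq_eq hx hy hxg hg hgx hgy hyx2 (key hg hgt htg)
  -- Replacing `g` by `xg` leaves the action on `N` unchanged and flips the sign of `β(xy, g)`.
  · have hxg' : x * g ∉ N := fun h => hg ((Subgroup.mul_mem_cancel_left N hx).1 h)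
    refine P.nonempty_of_conj_eq_of_sq_eq hx hy hxg hxg' ?_ ?_ hyx2 (key hxg' ?_ ?_)
    · rw [mul_assoc, hgx, ← mul_assoc, ← mul_assoc, hcomm]
    · rw [mul_assoc, hgy]
    · rw [← mul_assoc, P.comm _ ht _ hx, mul_assoc, hgt, mul_assoc]
    · rw [pairing_mul_right f (P.comm _ ht _ hx) hgt, htx, eq_neg_one_of_sq htg2 htg, neg_mul_neg,
        one_mul]

/-- A nonabelian group with a nondegenerate cocycle and a polarization is one of two groups. -/
theorem nonempty_mulEquiv (hf : Nondegenerate f) (hG : ¬ ∀ x y : G, x * y = y * x) :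
    Nonempty (G ≃* GroupIX) ∨ Nonempty (G ≃* GroupX) := by
  obtain ⟨g, -, hzg⟩ := hf z P.ne_one
  have hg : g ∉ N := mt (P.mem_iff g).1 hzg
  obtain ⟨x, hx, hgx⟩ : ∃ x ∈ N, g * x ≠ x * g := by
    by_contra! h
    refine hG fun a b => ?_
    have hga (a : G) : Commute g a := by
      by_cases ha : a ∈ N
      · exact h a ha
      · simpa using (Commute.refl g).inv_right.mul_right (h _ (P.mul_mem_of_notMem hg ha))
    have hNa {a : G} (ha : a ∈ N) (b : G) : Commute a b := by
      by_cases hb : b ∈ N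
      · exact P.comm a ha b hb
      · simpa using (hga a).symm.inv_right.mul_right
          (show Commute a (g * b) from P.comm a ha _ (P.mul_mem_of_notMem hg hb))
    by_cases ha : a ∈ N
    · exact hNa ha b
    · have : Commute (g⁻¹ * (g * a)) b :=
        (hga b).inv_left.mul_left (hNa (P.mul_mem_of_notMem hg ha) b)
      simpa using this.eq
  have hx1 : x ≠ 1 := by rintro rfl; simp at hgx
  obtain ⟨y, hxy, hxy1⟩ := hf x hx1
  -- If `y` were outside `N`, then `gy ∈ N` would commute with `x`, and so would `g`.
  have hy : y ∈ N := by
    by_contra hy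
    have h1 : Commute x (g * y) := P.comm x hx _ (P.mul_mem_of_notMem hg hy)
    have h2 : Commute x g := by
      simpa using h1.mul_right (show Commute x y from hxy).inv_right
    exact hgx h2.eq.symm
  by_cases hB : pairing f x (g * x * g⁻¹) = 1
  swap
  · exact P.nonempty_of_pairing_conj_ne_one hx hg hB
  by_cases hB' : pairing f y (g * y * g⁻¹) = 1
  swap
  · exact P.nonempty_of_pairing_conj_ne_one hy hg hB'
  have hyx1 : pairing f y x ≠ 1 := by rwa [pairing_symm, inv_ne_one]
  have aux {w v : G} (hw : w ∈ N) (hv : v ∈ N) (hwv : pairing f w v ≠ 1)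
      (h : pairing f w (g * w * g⁻¹) = 1) : g * w = w * g ∨ g * w = z * w * g := by
    have hz (u : G) : g * u * g⁻¹ = z → u = z := fun e => by
      rw [mul_inv_eq_iff_eq_mul, ← P.central] at e
      exact mul_left_cancel e
    rcases P.eq_of_pairing_eq_one hw hv hwv (P.conj_mem hw g) h with e | e | e | e
    · rw [conj_eq_one_iff] at e
      exact absurd (by rw [e, pairing_one_left]) hwv
    · rw [hz w e] at hwv
      exact absurd ((P.mem_iff v).1 hv) hwv
    · exact Or.inl (mul_inv_eq_iff_eq_mul.1 e)
    · rw [P.central] at e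
      exact Or.inr (mul_inv_eq_iff_eq_mul.1 e)
  have hgx' := (aux hx hy hxy1 hB).resolve_left hgx
  rcases aux hy hx hyx1 hB' with hgy | hgy
  · exact P.nonempty_of_conj_eq_mul hx hy hxy1 hg hgx' hgy
  -- If `g` multiplies both `x` and `y` by `z`, it fixes `xy`, which serves in place of `y`.
  · refine P.nonempty_of_conj_eq_mul hx (mul_mem hx hy) ?_ hg hgx' ?_
    · rwa [pairing_mul_right f rfl hxy, pairing_self, one_mul]
    · rw [← mul_assoc, hgx', mul_assoc (z * x), hgy, ← mul_assoc, ← mul_assoc, mul_assoc z,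
        P.central x, ← mul_assoc, P.mul_self, one_mul]

end IsPolarization

end TwistedGroupAlgebra

/-! ### Assembly of the classification. -/

open TwistedGroupAlgebra in
/-- The groups of central type of order 16 are among the four listed. -/
theorem IsCentralType.nonempty_mulEquiv {G : Type u} [Group G] (hG : Nat.card G = 16)
    (h : IsCentralType G) : Nonempty (G ≃* Cyc 4 × Cyc 4) ∨ Nonempty (G ≃* (Fin 4 → Cyc 2)) ∨
      Nonempty (G ≃* GroupIX) ∨ Nonempty (G ≃* GroupX) := by
  obtain ⟨_, f, hf⟩ := isCentralType_iff.1 h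
  have hf' : Nondegenerate f := fun g hg => by
    obtain ⟨k, hk, hne⟩ := hf g hg
    exact ⟨k, hk, fun e => hne (div_eq_one.1 e)⟩
  by_cases hcomm : ∀ x y : G, x * y = y * x
  · by_cases h2 : ∀ x : G, x ^ 2 = 1
    · exact Or.inr (Or.inl (nonempty_mulEquiv_cyc_two_pow hG hcomm h2))
    · push Not at h2
      obtain ⟨g, hg⟩ := h2
      exact Or.inl (nonempty_mulEquiv_cyc_four_prod hG hcomm hf' hg)
  · obtain ⟨N, z, P⟩ := exists_isPolarization hG hf'
    exact Or.inr (Or.inr (P.nonempty_mulEquiv hf' hcomm))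

theorem theorem2 :
    (∀ (G : Type u) [Group G],
      (Nat.card G = 16 ∧ IsCentralType G) ↔
        (Nonempty (G ≃* Cyc 4 × Cyc 4) ∨
          Nonempty (G ≃* (Fin 4 → Cyc 2)) ∨
          Nonempty (G ≃* GroupIX) ∨
          Nonempty (G ≃* GroupX))) ∧
    (∃ x y : GroupIX, x * y ≠ y * x) ∧
    (∃ x y : GroupX, x * y ≠ y * x) ∧
    IsEmpty (Cyc 4 × Cyc 4 ≃* (Fin 4 → Cyc 2)) ∧
    IsEmpty (GroupIX ≃* GroupX) :=
  ⟨fun _ _ => ⟨fun h => h.2.nonempty_mulEquiv h.1, card_and_isCentralType_of_mulEquiv⟩,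
    groupIX_not_comm, groupX_not_comm, isEmpty_cyc_four_prod_mulEquiv,
    isEmpty_groupIX_mulEquiv_groupX⟩
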